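/- Let $\Gamma=(G,\sigma)$ be a signed graph, i.e. a finite simple graph $G$ with a sign $\sigma(e)\in\{+1,-1\}$ on each edge $e$. Its adjacency matrix $A(\Gamma)$ has entry $\sigma(uv)$ at $(u,v)$ if $uv$ is an edge and $0$ otherwise, and its nullity $\eta(\Gamma)$ is the multiplicity of $0$ as an eigenvalue of $A(\Gamma)$. Call $\Gamma$ balanced if on every cycle of $G$ the product of the edge signs is $+1$, and unbalanced otherwise; call $\Gamma$ unicyclic if $G$ is connected and contains exactly one cycle. For integers $r\ge s\ge 0$ with $r+s\ge 1$, let $U_1(r,s)$ be the graph obtained from a triangle by attaching $r$ pendant edges at one vertex and $s$ pendant edges at another vertex, and let $U_2(r,s)$ be the graph obtained from the $4$-cycle by attaching $r$ pendant edges at one vertex and $s$ pendant edges at the vertex not adjacent to it. For $r\ge 1$, let $U_3(r)$ be the graph obtained from the $4$-cycle by identifying one of its vertices with a pendant vertex of the star $K_{1,r+1}$. **Theorem.** Let $\Gamma=(G,\sigma)$ be a unicyclic signed graph of order $n\ge 4$. Then $\eta(\Gamma)=n-4$ if and only if one of the following holds (graphs up to isomorphism): 1. $G=C_4$ and $\Gamma$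 is unbalanced; 2. $G=C_6$ and $\Gamma$ is unbalanced; 3. $G=U_1(r,s)$ for some $r\ge s\ge 0$ with $r+s\ge 1$; 4. $G=U_2(r,s)$ for some $r\ge s\ge 0$ with $r+s\ge 1$; 5. $G=U_3(r)$ for some $r\ge 1$ and $\Gamma$ is balanced. -/

import Mathlib

namespace SimpleGraph

/-- A (connected) unicyclic graph: a connected graph with exactly one cycle. Cycles are counted
as subgraphs, so that the choice of starting point and direction plays no role. -/
def IsUnicyclic {V : Type*} (G : SimpleGraph V) : Prop :=
  G.Connected ∧
    ∃! C : G.Subgraph, ∃ (v : V) (p : G.Walk v v), p.IsCycle ∧ p.toSubgraph = C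

/-- The graph obtained from disjoint graphs `G` and `H` by identifying the vertex `v` of `G` with
the vertex `w` of `H`; the identified vertex is represented by `v`. -/
def identify {V W : Type*} (G : SimpleGraph V) (v : V) (H : SimpleGraph W) (w : W) :
    SimpleGraph (V ⊕ {x : W // x ≠ w}) where
  Adj
    | .inl a, .inl b => G.Adj a b
    | .inl a, .inr y => a = v ∧ H.Adj w y
    | .inr x, .inl b => b = v ∧ H.Adj w x
    | .inr x, .inr y => H.Adj x y
  symm := ⟨by
    rintro (a | x) (b | y) h
    · exact SimpleGraph.Adj.symm h
    · exact h
    · exact h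
    · exact SimpleGraph.Adj.symm h⟩
  loopless := ⟨by
    rintro (a | x) h
    · exact G.loopless.irrefl a h
    · exact H.loopless.irrefl x h⟩

/-- The graph obtained from `G` by attaching, for every `p : P`, a new pendant vertex `p`
at the vertex `f p`. -/
def attachPendants {V P : Type*} (G : SimpleGraph V) (f : P → V) : SimpleGraph (V ⊕ P) where
  Adj
    | .inl a, .inl b => G.Adj a b
    | .inl a, .inr q => a = f q
    | .inr p, .inl b => b = f p
    | .inr _, .inr _ => False
  symm := ⟨by
    rintro (a | p) (b | q) h
    · exact SimpleGraph.Adj.symm h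
    · exact h
    · exact h
    · exact h⟩
  loopless := ⟨by
    rintro (a | p) h
    · exact G.loopless.irrefl a h
    · exact h⟩

/-- `U₁(r,s)`: a triangle with `r` pendant edges attached at one vertex and `s` at another. -/
def U₁ (r s : ℕ) : SimpleGraph (Fin 3 ⊕ (Fin r ⊕ Fin s)) :=
  (cycleGraph 3).attachPendants (Sum.elim (fun _ => 0) (fun _ => 1))

/-- `U₂(r,s)`: a square with `r` pendant edges attached at one vertex and `s` at the vertex
opposite to it. -/
def U₂ (r s : ℕ) : SimpleGraph (Fin 4 ⊕ (Fin r ⊕ Fin s)) :=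
  (cycleGraph 4).attachPendants (Sum.elim (fun _ => 0) (fun _ => 2))

/-- `U₃(r)`: a square with one vertex identified with a pendant vertex of the star `K_{1,r+1}`.
The centre of the star is `Sum.inl 0`, its pendant vertices are the `Sum.inr i`. -/
def U₃ (r : ℕ) :
    SimpleGraph (Fin 4 ⊕ {x : Fin 1 ⊕ Fin (r + 1) // x ≠ Sum.inr 0}) :=
  (cycleGraph 4).identify 0 (completeBipartiteGraph (Fin 1) (Fin (r + 1))) (Sum.inr 0)

end SimpleGraph

/-- A signed graph: a simple graph together with a sign `1` or `-1` on each edge. -/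
structure SignedGraph (V : Type*) where
  /-- The underlying graph. -/
  graph : SimpleGraph V
  /-- The edge labelling. -/
  sign : graph.edgeSet → ℤˣ

namespace SignedGraph

/-- The product of the signs of the edges traversed by a walk. -/
def walkSign {V : Type*} (Γ : SignedGraph V) {u v : V} (p : Γ.graph.Walk u v) : ℤˣ :=
  (p.darts.map fun d => Γ.sign ⟨d.edge, d.edge_mem⟩).prod

/-- A signed graph is balanced if all its cycles are positive. -/
def IsBalanced {V : Type*} (Γ : SignedGraph V) : Prop :=
  ∀ (v : V) (p : Γ.graph.Walk v v), p.IsCycle → Γ.walkSign p = 1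

open Classical in
/-- The (real) adjacency matrix of a signed graph. -/
noncomputable def adjMatrix {V : Type*} (Γ : SignedGraph V) : Matrix V V ℝ :=
  Matrix.of fun u v =>
    if h : Γ.graph.Adj u v then (((Γ.sign ⟨s(u, v), h⟩ : ℤˣ) : ℤ) : ℝ) else 0

/-- The nullity of a signed graph: the multiplicity of the eigenvalue zero of its adjacency
matrix. -/
noncomputable def nullity {V : Type*} [Fintype V] [DecidableEq V] (Γ : SignedGraph V) : ℕ :=
  Γ.adjMatrix.charpoly.rootMultiplicity 0

end SignedGraph

/-! Since a real symmetric matrix of order n has nullity n minus rank, the question is which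
unicyclic signed graphs have adjacency matrix of rank 4. The tool is a Schur complement: for a
symmetric A with A a a = A b b = 0 and A a b ≠ 0, eliminating rows and columns a, b lowers the rank
by exactly 2. So rank 4 means that two such eliminations reach the zero matrix, which is a condition
on individual entries.

A unicyclic graph has as many edges as vertices. With no vertex of degree 1 it is therefore
2-regular, hence a cycle, and eliminating along its edges settles it: for C_4 and C_6 one last entry
remains, governed by the sign product, while C_5 and all cycles of length at least 7 have rank
greater than 4.

If x is pendant at y, eliminating the edge xy just deletes x and y. The rest must have rank 2. A
symmetric rank 2 matrix with zero diagonal is supported on a complete bipartite graph with parts P,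
Q, and its entries factor so that every 4-cycle is positive. The remaining vertices are pendant at y
(`exists_isBicliqueApex`). If y has d neighbours in P ∪ Q, the handshake lemma gives (|P| - 1)(|Q| -
1) + d = 2, and connectivity gives d ≥ 1. Either a part is a singleton and d = 2, which gives U₁ or
U₂, or |P| = |Q| = 2 and d = 1, which gives U₃ with a positive square
(`IsBicliqueApex.classification`). Conversely, in these graphs deleting a pendant vertex and its
neighbour leaves, up to isolated vertices, a star or a balanced square, both of rank 2. -/

namespace Matrix

/-! ### Hyperbolic pivots and rank -/

variable {V : Type*}

/-- The Schur complement of the hyperbolic pivot with rows and columns `a`, `b`, padded by zeros: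
it is meant for symmetric matrices with `A a a = A b b = 0` and `A a b ≠ 0`. -/
noncomputable def pivot (A : Matrix V V ℝ) (a b : V) : Matrix V V ℝ :=
  of fun u v => A u v - (A a b)⁻¹ * (A u a * A b v + A u b * A a v)

theorem pivot_apply (A : Matrix V V ℝ) (a b u v : V) :
    A.pivot a b u v = A u v - (A a b)⁻¹ * (A u a * A b v + A u b * A a v) := rfl

theorem IsSymm.pivot {A : Matrix V V ℝ} (hA : A.IsSymm) (a b : V) : (A.pivot a b).IsSymm := by
  ext u v
  simp only [transpose_apply, pivot_apply]
  rw [hA.apply u v, hA.apply v a, hA.apply b u, hA.apply v b, hA.apply a u]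
  ring

theorem rank_eq_zero_iff [Fintype V] [DecidableEq V] (A : Matrix V V ℝ) :
    A.rank = 0 ↔ A = 0 := by
  constructor
  · intro h
    rw [Matrix.rank, Submodule.finrank_eq_zero, LinearMap.range_eq_bot] at h
    ext i j
    have := congrFun (LinearMap.congr_fun h (Pi.single j 1)) i
    simpa using this
  · rintro rfl
    exact Matrix.rank_zero

/-- The kernel of the pivot contains that of A, and z ↦ ((A z) a, (A z) b) maps it onto ℝ² with
kernel exactly ker A. Because the pivot is padded by zeros to the same size, the kernel dimensions
can be compared directly. -/
theorem IsSymm.rank_eq_rank_pivot_add_two [Fintype V] [DecidableEq V] {A : Matrix V V ℝ}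
    (hA : A.IsSymm) {a b : V} (ha : A a a = 0) (hb : A b b = 0) (hab : A a b ≠ 0) :
    A.rank = (A.pivot a b).rank + 2 := by
  have hba : A b a = A a b := hA.apply a b
  have key : ∀ (z : V → ℝ) (u : V), (A.pivot a b *ᵥ z) u =
      (A *ᵥ z) u - (A a b)⁻¹ * (A u a * (A *ᵥ z) b + A u b * (A *ᵥ z) a) := by
    intro z u
    simp only [mulVec, dotProduct, pivot_apply, Finset.mul_sum, ← Finset.sum_add_distrib,
      ← Finset.sum_sub_distrib]
    exact Finset.sum_congr rfl fun i _ => by ring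
  let N := LinearMap.ker (A.pivot a b).mulVecLin
  let T : N →ₗ[ℝ] ℝ × ℝ :=
    (((LinearMap.proj a).comp A.mulVecLin).prod ((LinearMap.proj b).comp A.mulVecLin)).comp
      N.subtype
  have hT : ∀ z : N, T z = ((A *ᵥ z.1) a, (A *ᵥ z.1) b) := fun z => rfl
  have hsurj : LinearMap.range T = ⊤ := by
    rw [LinearMap.range_eq_top]
    rintro ⟨s, t⟩
    -- The basis vectors at a and b are killed by the pivot. The coefficients are crossed because A
    -- sends the vector at a to a vector with entries 0 at a and A a b at b, and vice versa.
    refine ⟨⟨(t * (A a b)⁻¹) • Pi.single a 1 + (s * (A a b)⁻¹) • Pi.single b 1, ?_⟩, ?_⟩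
    · change (A.pivot a b) *ᵥ _ = 0
      ext u
      rw [key]
      simp only [mulVec_add, mulVec_smul, mulVec_single_one, Pi.add_apply, Pi.smul_apply, col_apply,
        smul_eq_mul, ha, hb, hba, Pi.zero_apply]
      field_simp
      ring
    · rw [hT]
      simp only [mulVec_add, mulVec_smul, mulVec_single_one, Pi.add_apply, Pi.smul_apply, col_apply,
        smul_eq_mul, ha, hb, hba]
      ext <;> simp [hab]
  have hker : Module.finrank ℝ (LinearMap.ker T) =
      Module.finrank ℝ (LinearMap.ker A.mulVecLin) := by
    have hle : LinearMap.ker A.mulVecLin ≤ N := by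
      intro z hz
      have hz' : A *ᵥ z = 0 := hz
      change (A.pivot a b) *ᵥ _ = 0
      ext u
      rw [key, hz']
      simp
    have : LinearMap.ker T = (LinearMap.ker A.mulVecLin).comap N.subtype := by
      ext ⟨z, hz⟩
      rw [LinearMap.mem_ker, hT, Submodule.mem_comap]
      change _ ↔ A *ᵥ z = 0
      constructor
      · intro h
        rw [Prod.mk_eq_zero] at h
        ext u
        have hz' : (A.pivot a b) *ᵥ z = 0 := hz
        have := key z u
        rw [hz', h.1, h.2] at this
        simpa using this.symm
      · intro h
        simp [h]
    rw [this]
    exact (Submodule.comapSubtypeEquivOfLe hle).finrank_eq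
  have h1 := LinearMap.finrank_range_add_finrank_ker T
  have h2 := LinearMap.finrank_range_add_finrank_ker A.mulVecLin
  have h3 := LinearMap.finrank_range_add_finrank_ker (A.pivot a b).mulVecLin
  rw [hsurj, finrank_top, Module.finrank_prod, Module.finrank_self, hker] at h1
  change _ + Module.finrank ℝ N = _ at h3
  simp only [Matrix.rank]
  omega

theorem IsSymm.rank_eq_two_iff [Fintype V] [DecidableEq V] {A : Matrix V V ℝ}
    (hA : A.IsSymm) {a b : V} (ha : A a a = 0) (hb : A b b = 0) (hab : A a b ≠ 0) :
    A.rank = 2 ↔ ∀ u v, A.pivot a b u v = 0 := by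
  rw [hA.rank_eq_rank_pivot_add_two ha hb hab, Nat.add_eq_right, rank_eq_zero_iff]
  exact ⟨fun h u v => by rw [h]; rfl, fun h => by ext u v; exact h u v⟩

theorem IsSymm.rank_eq_four_iff [Fintype V] [DecidableEq V] {A : Matrix V V ℝ}
    (hA : A.IsSymm) {a b : V} (ha : A a a = 0) (hb : A b b = 0) (hab : A a b ≠ 0) :
    A.rank = 4 ↔ (A.pivot a b).rank = 2 := by
  rw [hA.rank_eq_rank_pivot_add_two ha hb hab]
  omega

/-- By the spectral theorem the rank counts the nonzero eigenvalues, and the root multiplicity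
counts the zero ones. -/
theorem IsSymm.rootMultiplicity_charpoly_zero [Fintype V] [DecidableEq V] {A : Matrix V V ℝ}
    (hA : A.IsSymm) : A.charpoly.rootMultiplicity 0 + A.rank = Fintype.card V := by
  have hH : A.IsHermitian := by
    rw [Matrix.IsHermitian, conjTranspose_eq_transpose_of_trivial]; exact hA
  rw [hH.rank_eq_card_non_zero_eigs, ← Polynomial.count_roots, hH.roots_charpoly_eq_eigenvalues,
    Multiset.count_map, Fintype.card_subtype]
  rw [← Finset.filter_val, ← Finset.card_def]
  rw [← Finset.card_univ, ← Finset.card_filter_add_card_filter_not (s := Finset.univ)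
    (fun i => (0 : ℝ) = hH.eigenvalues i)]
  simp [eq_comm]

end Matrix

/-! ### The signed adjacency matrix -/

namespace SignedGraph

variable {V : Type*} (Γ : SignedGraph V)

theorem adjMatrix_ne_zero_iff {u v : V} : Γ.adjMatrix u v ≠ 0 ↔ Γ.graph.Adj u v := by
  by_cases h : Γ.graph.Adj u v <;> simp [adjMatrix, h]

theorem adjMatrix_eq_zero_iff {u v : V} : Γ.adjMatrix u v = 0 ↔ ¬ Γ.graph.Adj u v := by
  rw [← adjMatrix_ne_zero_iff, not_not]

theorem adjMatrix_self (v : V) : Γ.adjMatrix v v = 0 :=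
  Γ.adjMatrix_eq_zero_iff.2 (Γ.graph.irrefl)

theorem adjMatrix_apply_of_adj {u v : V} (h : Γ.graph.Adj u v) :
    Γ.adjMatrix u v = (((Γ.sign ⟨s(u, v), h⟩ : ℤˣ) : ℤ) : ℝ) := by
  simp [adjMatrix, h]

theorem adjMatrix_isSymm : Γ.adjMatrix.IsSymm := by
  ext u v
  rw [Matrix.transpose_apply]
  by_cases h : Γ.graph.Adj u v
  · rw [Γ.adjMatrix_apply_of_adj h, Γ.adjMatrix_apply_of_adj h.symm]
    simp only [Sym2.eq_swap]
  · rw [Γ.adjMatrix_eq_zero_iff.2 h, Γ.adjMatrix_eq_zero_iff.2 (fun h' => h h'.symm)]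

theorem adjMatrix_comm (u v : V) : Γ.adjMatrix u v = Γ.adjMatrix v u :=
  Γ.adjMatrix_isSymm.apply v u

theorem adjMatrix_mul_self {u v : V} (h : Γ.graph.Adj u v) :
    Γ.adjMatrix u v * Γ.adjMatrix u v = 1 := by
  rw [Γ.adjMatrix_apply_of_adj h]
  rcases Int.units_eq_one_or (Γ.sign ⟨s(u, v), h⟩) with h | h <;> simp [h]

theorem adjMatrix_inv {u v : V} (h : Γ.graph.Adj u v) :
    (Γ.adjMatrix u v)⁻¹ = Γ.adjMatrix u v :=
  inv_eq_of_mul_eq_one_left (Γ.adjMatrix_mul_self h)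

theorem nullity_eq_sub_four_iff [Fintype V] [DecidableEq V] (h : 4 ≤ Fintype.card V) :
    Γ.nullity = Fintype.card V - 4 ↔ Γ.adjMatrix.rank = 4 := by
  have := Γ.adjMatrix_isSymm.rootMultiplicity_charpoly_zero
  unfold nullity
  omega

end SignedGraph

/-! ### Unicyclic graphs -/

namespace SimpleGraph

variable {V : Type*} {G : SimpleGraph V}

theorem Preconnected.mem_of_forall_adj (hG : G.Preconnected) (S : Set V)
    (hS : ∀ u ∈ S, ∀ v, G.Adj u v → v ∈ S) {u : V} (hu : u ∈ S) (v : V) : v ∈ S := by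
  obtain ⟨p⟩ := hG u v
  induction p with
  | nil => exact hu
  | cons h p ih => exact ih (hS _ hu _ h)

/-- Uniqueness is stated for subgraphs; this turns it into a statement on edge lists, which is what
sign products need. A cycle repeats no edge, so equal edge sets suffice. -/
theorem IsUnicyclic.edges_perm (hG : G.IsUnicyclic) {u v : V} {p : G.Walk u u} {q : G.Walk v v}
    (hp : p.IsCycle) (hq : q.IsCycle) : p.edges.Perm q.edges := by
  have h : p.toSubgraph = q.toSubgraph := hG.2.unique ⟨u, p, hp, rfl⟩ ⟨v, q, hq, rfl⟩
  rw [List.perm_ext_iff_of_nodup hp.isTrail.edges_nodup hq.isTrail.edges_nodup]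
  intro e
  rw [← Walk.mem_edges_toSubgraph, h, Walk.mem_edges_toSubgraph]

theorem IsUnicyclic.exists_isCycle (hG : G.IsUnicyclic) :
    ∃ (v : V) (p : G.Walk v v), p.IsCycle := by
  obtain ⟨_, ⟨v, p, hp, _⟩, _⟩ := hG.2
  exact ⟨v, p, hp⟩

/-- Delete an edge of the cycle: it is not a bridge, so the graph stays connected, and a surviving
cycle would have to use the deleted edge. What is left is a spanning tree. -/
theorem IsUnicyclic.card_edgeFinset [Fintype V] [Fintype G.edgeSet] (hG : G.IsUnicyclic) :
    G.edgeFinset.card = Fintype.card V := by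
  classical
  obtain ⟨v, p, hp⟩ := hG.exists_isCycle
  obtain ⟨e, he⟩ : ∃ e, e ∈ p.edges := by
    have := hp.three_le_length
    rw [← Walk.length_edges] at this
    exact List.exists_mem_of_length_pos (by omega)
  have heG := p.edges_subset_edgeSet he
  induction e with | _ a b =>
  have hconn : (G.deleteEdges {s(a, b)}).Connected := by
    apply hG.1.connected_delete_edge_of_not_isBridge
    intro hb
    exact hb.notMem_edges_of_isCycle hp he
  have hacyc : (G.deleteEdges {s(a, b)}).IsAcyclic := by
    intro w c hc
    have hle : G.deleteEdges {s(a, b)} ≤ G := G.deleteEdges_le _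
    have hc' := hc.mapLe hle
    have := (hG.edges_perm hp hc').mem_iff.1 he
    rw [Walk.edges_mapLe_eq_edges] at this
    have := c.edges_subset_edgeSet this
    simp at this
  have htree : (G.deleteEdges {s(a, b)}).IsTree := ⟨hconn, hacyc⟩
  have := htree.card_edgeFinset
  have hdel : (G.deleteEdges {s(a, b)}).edgeFinset = G.edgeFinset.erase s(a, b) := by
    ext e
    simp [and_comm]
  rw [← this, hdel, Finset.card_erase_add_one]
  simpa using heG

theorem IsUnicyclic.sum_degrees [Fintype V] [DecidableRel G.Adj] (hG : G.IsUnicyclic) :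
    ∑ v, G.degree v = 2 * Fintype.card V := by
  rw [G.sum_degrees_eq_twice_card_edges, hG.card_edgeFinset]

/-- `f 0, f 1, …, f (m - 1)` enumerate the vertices of the graph along a cycle containing all
edges. -/
structure IsCycleLabelling (G : SimpleGraph V) (m : ℕ) (f : ℕ → V) : Prop where
  surj : ∀ v, ∃ i < m, f i = v
  inj : ∀ i < m, ∀ j < m, f i = f j → i = j
  adj_iff : ∀ i < m, ∀ j < m, G.Adj (f i) (f j) ↔
    (j = i + 1 ∨ i = j + 1 ∨ (i = 0 ∧ j + 1 = m) ∨ (j = 0 ∧ i + 1 = m))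

/-- All degrees are at least 2 and sum to 2n, so all equal 2. The cycle already uses both neighbours
of each of its vertices, hence it is closed under adjacency and, by connectedness, is the whole
graph. -/
theorem IsUnicyclic.exists_isCycleLabelling [Fintype V] [DecidableRel G.Adj] (hG : G.IsUnicyclic)
    (hdeg : ∀ v, G.degree v ≠ 1) (hcard : 2 ≤ Fintype.card V) :
    ∃ f, G.IsCycleLabelling (Fintype.card V) f := by
  classical
  have : Nontrivial V := Fintype.one_lt_card_iff_nontrivial.1 hcard
  have hdeg2 : ∀ v, 2 ≤ G.degree v := by
    intro v
    have h0 : 0 < G.degree v := hG.1.preconnected.degree_pos_of_nontrivial v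
    have := hdeg v
    omega
  have hreg : ∀ v, G.degree v = 2 := by
    have hs : ∑ v, G.degree v = ∑ _v : V, 2 := by
      rw [hG.sum_degrees, Finset.sum_const, Finset.card_univ, smul_eq_mul, mul_comm]
    intro v
    exact ((Finset.sum_eq_sum_iff_of_le (fun v _ => hdeg2 v)).1 hs.symm v (Finset.mem_univ v)).symm
  obtain ⟨v₀, p, hp⟩ := hG.exists_isCycle
  have hl := hp.three_le_length
  have hnb : ∀ v ∈ p.support, p.toSubgraph.neighborSet v = G.neighborSet v := by
    intro v hv
    apply Set.eq_of_subset_of_ncard_le (p.toSubgraph.neighborSet_subset v)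
    · rw [hp.ncard_neighborSet_toSubgraph_eq_two hv, Set.ncard_eq_toFinset_card']
      exact (hreg v).le
  have hsupp : ∀ v, v ∈ p.support := by
    intro v
    refine hG.1.preconnected.mem_of_forall_adj {u | u ∈ p.support} (fun a ha b h => ?_)
      p.start_mem_support v
    have : b ∈ p.toSubgraph.neighborSet a := by rw [hnb a ha]; exact h
    rw [Set.mem_ofPred_eq, ← Walk.mem_verts_toSubgraph]
    exact this.snd_mem
  have hsurj : ∀ v, ∃ i < p.length, p.getVert i = v := by
    intro v
    obtain ⟨i, hi, hle⟩ := Walk.mem_support_iff_exists_getVert.1 (hsupp v)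
    rcases hle.lt_or_eq with h | h
    · exact ⟨i, h, hi⟩
    -- The closing index `p.length` revisits the starting vertex, so it is replaced by 0.
    · refine ⟨0, by omega, ?_⟩
      rw [h, Walk.getVert_length] at hi
      rw [Walk.getVert_zero, hi]
  have hinj : ∀ i < p.length, ∀ j < p.length, p.getVert i = p.getVert j → i = j := by
    intro i hi j hj h
    exact hp.getVert_injOn' (by simp; omega) (by simp; omega) h
  have hlen : p.length = Fintype.card V := by
    rw [← Fintype.card_fin p.length]
    apply Fintype.card_of_bijective (f := fun i : Fin p.length => p.getVert i)
    constructor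
    · intro i j h
      exact Fin.ext (hinj _ i.2 _ j.2 h)
    · intro v
      obtain ⟨i, hi, h⟩ := hsurj v
      exact ⟨⟨i, hi⟩, h⟩
  rw [← hlen]
  refine ⟨p.getVert, hsurj, hinj, ?_⟩
  intro i hi j hj
  rw [← mem_neighborSet, ← hnb _ (hsupp _)]
  have hlast : p.getVert p.length = p.getVert 0 := by simp
  by_cases hi0 : i = 0
  · subst hi0
    rw [Walk.getVert_zero, hp.neighborSet_toSubgraph_endpoint]
    simp only [Set.mem_insert_iff, Set.mem_singleton_iff]
    rw [show p.snd = p.getVert 1 from rfl, show p.penultimate = p.getVert (p.length - 1) from rfl]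
    constructor
    · rintro (h | h)
      · have := hinj _ hj _ (by omega) h; omega
      · have := hinj _ hj _ (by omega) h; exact .inr (.inr (.inl ⟨trivial, by omega⟩))
    · rintro (h | h | h | h)
      · left; rw [h]
      · omega
      · right; congr 1; omega
      · omega
  · rw [hp.neighborSet_toSubgraph_internal hi0 hi]
    simp only [Set.mem_insert_iff, Set.mem_singleton_iff]
    by_cases him : i + 1 = p.length
    · rw [him, hlast]
      constructor
      · rintro (h | h)
        · have := hinj _ hj _ (by omega) h; omega
        · have := hinj _ hj _ (by omega) h; omega
      · rintro (h | h | h | h)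
        · omega
        · left; congr 1; omega
        · omega
        · right; rw [h.1]
    · constructor
      · rintro (h | h)
        · have := hinj _ hj _ (by omega) h; omega
        · have := hinj _ hj _ (by omega) h; omega
      · rintro (h | h | h | h)
        · right; rw [h]
        · left; congr 1; omega
        · omega
        · omega

end SimpleGraph

/-! ### Balance read off a single cycle -/

namespace SignedGraph

variable {V : Type*} (Γ : SignedGraph V)

-- The product now depends only on the list of edges, hence is invariant under permuting it. The
-- default value 1 is never attained through a non-edge, since walks use only edges.
open Classical in
theorem walkSign_eq_prod_edges {u v : V} (p : Γ.graph.Walk u v) :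
    Γ.walkSign p = (p.edges.map fun e =>
      if h : e ∈ Γ.graph.edgeSet then Γ.sign ⟨e, h⟩ else 1).prod := by
  rw [walkSign, SimpleGraph.Walk.edges, List.map_map]
  congr 1
  apply List.map_congr_left
  intro d _
  simp [d.edge_mem]

theorem isBalanced_iff_of_isCycle (hΓ : Γ.graph.IsUnicyclic) {v : V} {p : Γ.graph.Walk v v}
    (hp : p.IsCycle) : Γ.IsBalanced ↔ Γ.walkSign p = 1 := by
  refine ⟨fun h => h v p hp, fun h u q hq => ?_⟩
  rw [← h, walkSign_eq_prod_edges, walkSign_eq_prod_edges]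
  exact ((hΓ.edges_perm hq hp).map _).prod_eq

theorem walkSign_cons {u v w : V} (h : Γ.graph.Adj u v) (p : Γ.graph.Walk v w) :
    ((Γ.walkSign (.cons h p) : ℤ) : ℝ) = Γ.adjMatrix u v * ((Γ.walkSign p : ℤ) : ℝ) := by
  simp [walkSign, Γ.adjMatrix_apply_of_adj h, SimpleGraph.Dart.edge]

theorem walkSign_nil {u : V} : Γ.walkSign (.nil : Γ.graph.Walk u u) = 1 := rfl

theorem walkSign_eq_one_iff {u v : V} (p : Γ.graph.Walk u v) :
    Γ.walkSign p = 1 ↔ ((Γ.walkSign p : ℤ) : ℝ) = 1 := by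
  rcases Int.units_eq_one_or (Γ.walkSign p) with h | h <;> (simp [h]; try norm_num)

variable {Γ}

theorem isBalanced_iff_of_square (hΓ : Γ.graph.IsUnicyclic) {a b c d : V}
    (hab : Γ.graph.Adj a b) (hbc : Γ.graph.Adj b c) (hcd : Γ.graph.Adj c d)
    (hda : Γ.graph.Adj d a) (hac : a ≠ c) (hbd : b ≠ d) :
    Γ.IsBalanced ↔ Γ.adjMatrix a b * Γ.adjMatrix b c * Γ.adjMatrix c d * Γ.adjMatrix d a = 1 := by
  have hp : (SimpleGraph.Walk.cons hab (.cons hbc (.cons hcd (.cons hda .nil)))).IsCycle := by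
    have := hab.ne; have := hbc.ne; have := hcd.ne; have := hda.ne
    rw [SimpleGraph.Walk.cons_isCycle_iff]
    simp [SimpleGraph.Walk.cons_isPath_iff]
    grind
  rw [Γ.isBalanced_iff_of_isCycle hΓ hp, walkSign_eq_one_iff]
  simp [walkSign_cons, walkSign_nil, mul_assoc]

theorem isBalanced_iff_of_hexagon (hΓ : Γ.graph.IsUnicyclic) {f : ℕ → V}
    (hf : Γ.graph.IsCycleLabelling 6 f) :
    Γ.IsBalanced ↔ Γ.adjMatrix (f 0) (f 1) * Γ.adjMatrix (f 1) (f 2) * Γ.adjMatrix (f 2) (f 3) *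
      Γ.adjMatrix (f 3) (f 4) * Γ.adjMatrix (f 4) (f 5) * Γ.adjMatrix (f 5) (f 0) = 1 := by
  have hadj := hf.adj_iff
  have hp : (SimpleGraph.Walk.cons (u := f 0) (v := f 1) ((hadj _ (by simp) _ (by simp)).2 (by simp))
      (.cons (v := f 2) ((hadj _ (by simp) _ (by simp)).2 (by simp))
      (.cons (v := f 3) ((hadj _ (by simp) _ (by simp)).2 (by simp))
      (.cons (v := f 4) ((hadj _ (by simp) _ (by simp)).2 (by simp))
      (.cons (v := f 5) ((hadj _ (by simp) _ (by simp)).2 (by simp))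
      (.cons (v := f 0) (G := Γ.graph)
        ((hadj _ (by simp) _ (by simp)).2 (by simp)) .nil)))))).IsCycle := by
    rw [SimpleGraph.Walk.cons_isCycle_iff]
    have h6 : ∀ i < 6, ∀ j < 6, f i = f j ↔ i = j :=
      fun i hi j hj => ⟨hf.inj i hi j hj, fun h => by rw [h]⟩
    simp [SimpleGraph.Walk.cons_isPath_iff, h6]
  rw [Γ.isBalanced_iff_of_isCycle hΓ hp, walkSign_eq_one_iff]
  simp [walkSign_cons, walkSign_nil, mul_assoc]

end SignedGraph

/-! ### Zero rows and columns of a pivot -/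

namespace Matrix

variable {V : Type*} {A : Matrix V V ℝ}

theorem pivot_apply_fst_left {a b : V} (ha : A a a = 0) (hab : A a b ≠ 0) (v : V) :
    A.pivot a b a v = 0 := by
  rw [pivot_apply, ha]
  field_simp
  ring

theorem IsSymm.pivot_apply_snd_left (hA : A.IsSymm) {a b : V} (hb : A b b = 0) (hab : A a b ≠ 0)
    (v : V) : A.pivot a b b v = 0 := by
  rw [pivot_apply, hb, hA.apply a b]
  field_simp
  ring

theorem IsSymm.pivot_apply_fst_right (hA : A.IsSymm) {a b : V} (ha : A a a = 0) (hab : A a b ≠ 0)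
    (v : V) : A.pivot a b v a = 0 := by
  rw [(hA.pivot a b).apply a v, pivot_apply_fst_left ha hab]

theorem IsSymm.pivot_apply_snd_right (hA : A.IsSymm) {a b : V} (hb : A b b = 0) (hab : A a b ≠ 0)
    (v : V) : A.pivot a b v b = 0 := by
  rw [(hA.pivot a b).apply b v, hA.pivot_apply_snd_left hb hab]

theorem pivot_apply_of_row_eq_zero {u : V} (hu : ∀ v, A u v = 0) (a b v : V) :
    A.pivot a b u v = 0 := by
  simp [pivot_apply, hu]

end Matrix

/-! ### Rank of signed cycles -/

namespace SignedGraph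

open Matrix

variable {V : Type*} {Γ : SignedGraph V} {f : ℕ → V}

theorem adjMatrix_eq_zero_of_isCycleLabelling {m : ℕ} (hf : Γ.graph.IsCycleLabelling m f)
    {i j : ℕ} (hi : i < m) (hj : j < m)
    (h : ¬ (j = i + 1 ∨ i = j + 1 ∨ (i = 0 ∧ j + 1 = m) ∨ (j = 0 ∧ i + 1 = m))) :
    Γ.adjMatrix (f i) (f j) = 0 := by
  rw [Γ.adjMatrix_eq_zero_iff, hf.adj_iff i hi j hj]
  exact h

variable [Fintype V] [DecidableEq V]

/-- Eliminating the edge 01 leaves only the entry at (2,3), equal to A 23 - A 01 · A 12 · A 30 in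
terms of the cycle edges. It vanishes exactly when the sign product is 1. -/
theorem rank_eq_four_iff_of_square (hΓ : Γ.graph.IsUnicyclic)
    (hf : Γ.graph.IsCycleLabelling 4 f) : Γ.adjMatrix.rank = 4 ↔ ¬ Γ.IsBalanced := by
  have hadj := hf.adj_iff
  have h01 : Γ.graph.Adj (f 0) (f 1) := (hadj 0 (by simp) 1 (by simp)).2 (by simp)
  have h12 : Γ.graph.Adj (f 1) (f 2) := (hadj 1 (by simp) 2 (by simp)).2 (by simp)
  have h23 : Γ.graph.Adj (f 2) (f 3) := (hadj 2 (by simp) 3 (by simp)).2 (by simp)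
  have h30 : Γ.graph.Adj (f 3) (f 0) := (hadj 3 (by simp) 0 (by simp)).2 (by simp)
  rw [isBalanced_iff_of_square hΓ h01 h12 h23 h30
    (fun h => absurd (hf.inj 0 (by simp) 2 (by simp) h) (by simp))
    (fun h => absurd (hf.inj 1 (by simp) 3 (by simp) h) (by simp))]
  have hA := Γ.adjMatrix_isSymm
  have e01 := Γ.adjMatrix_mul_self h01
  have e12 := Γ.adjMatrix_mul_self h12
  have e23 := Γ.adjMatrix_mul_self h23
  have e30 := Γ.adjMatrix_mul_self h30
  have i01 := Γ.adjMatrix_inv h01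
  have n01 := Γ.adjMatrix_ne_zero_iff.2 h01
  have z : ∀ i, Γ.adjMatrix (f i) (f i) = 0 := fun i => Γ.adjMatrix_self _
  have z02 : Γ.adjMatrix (f 0) (f 2) = 0 :=
    adjMatrix_eq_zero_of_isCycleLabelling hf (by simp) (by simp) (by simp)
  have z13 : Γ.adjMatrix (f 1) (f 3) = 0 :=
    adjMatrix_eq_zero_of_isCycleLabelling hf (by simp) (by simp) (by simp)
  have c30 := Γ.adjMatrix_comm (f 0) (f 3)
  have c12 := Γ.adjMatrix_comm (f 2) (f 1)
  have c02 := Γ.adjMatrix_comm (f 2) (f 0)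
  have c13 := Γ.adjMatrix_comm (f 3) (f 1)
  generalize Γ.adjMatrix = A at *
  rw [hA.rank_eq_four_iff (z 0) (z 1) n01]
  have hB := hA.pivot (f 0) (f 1)
  have r0 := pivot_apply_fst_left (z 0) n01
  have r1 := hA.pivot_apply_snd_left (z 1) n01
  have s0 := hA.pivot_apply_fst_right (z 0) n01
  have s1 := hA.pivot_apply_snd_right (z 1) n01
  have b22 : A.pivot (f 0) (f 1) (f 2) (f 2) = 0 := by simp [pivot_apply, z, z02, c02]
  have b33 : A.pivot (f 0) (f 1) (f 3) (f 3) = 0 := by simp [pivot_apply, z, z13, c13]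
  have b23 : A.pivot (f 0) (f 1) (f 2) (f 3) =
      A (f 2) (f 3) - A (f 0) (f 1) * (A (f 1) (f 2) * A (f 3) (f 0)) := by
    simp [pivot_apply, z02, c02, c12, c30, i01]
  have b32 := hB.apply (f 2) (f 3)
  generalize A.pivot (f 0) (f 1) = B at *
  by_cases h : B (f 2) (f 3) = 0
  · have hB0 : B = 0 := by
      ext u v
      obtain ⟨i, hi, rfl⟩ := hf.surj u
      obtain ⟨j, hj, rfl⟩ := hf.surj v
      rw [h] at b32
      interval_cases i <;> interval_cases j <;> simp_all
    rw [hB0, Matrix.rank_zero]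
    rw [b23, sub_eq_zero] at h
    simp only [OfNat.zero_ne_ofNat, false_iff, not_not]
    rw [← e23, h]
    ring
  · rw [hB.rank_eq_two_iff b22 b33 h]
    refine iff_of_true (fun u v => ?_) ?_
    · obtain ⟨i, hi, rfl⟩ := hf.surj u
      interval_cases i
      · exact pivot_apply_of_row_eq_zero r0 _ _ _
      · exact pivot_apply_of_row_eq_zero r1 _ _ _
      · exact pivot_apply_fst_left b22 h v
      · exact hB.pivot_apply_snd_left b33 h v
    · intro h'
      apply h
      rw [b23]
      linear_combination (-A (f 2) (f 3)) * h' +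
        A (f 0) (f 1) * (A (f 1) (f 2) * A (f 3) (f 0)) * e23

/-- Eliminating the edge 01 leaves a weighted triangle on 2, 3, 4. Eliminating 23 as well puts a
nonzero multiple of B 42 · B 34 on the diagonal at 4. -/
theorem rank_ne_four_of_pentagon (hf : Γ.graph.IsCycleLabelling 5 f) :
    Γ.adjMatrix.rank ≠ 4 := by
  have hadj := hf.adj_iff
  have hA := Γ.adjMatrix_isSymm
  have n01 := Γ.adjMatrix_ne_zero_iff.2 ((hadj 0 (by simp) 1 (by simp)).2 (by simp))
  have n12 := Γ.adjMatrix_ne_zero_iff.2 ((hadj 1 (by simp) 2 (by simp)).2 (by simp))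
  have n23 := Γ.adjMatrix_ne_zero_iff.2 ((hadj 2 (by simp) 3 (by simp)).2 (by simp))
  have n34 := Γ.adjMatrix_ne_zero_iff.2 ((hadj 3 (by simp) 4 (by simp)).2 (by simp))
  have n40 := Γ.adjMatrix_ne_zero_iff.2 ((hadj 4 (by simp) 0 (by simp)).2 (by simp))
  have z : ∀ i, Γ.adjMatrix (f i) (f i) = 0 := fun i => Γ.adjMatrix_self _
  have z' : ∀ i < 5, ∀ j < 5,
      ¬ (j = i + 1 ∨ i = j + 1 ∨ (i = 0 ∧ j + 1 = 5) ∨ (j = 0 ∧ i + 1 = 5)) →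
      Γ.adjMatrix (f i) (f j) = 0 :=
    fun i hi j hj h => adjMatrix_eq_zero_of_isCycleLabelling hf hi hj h
  generalize Γ.adjMatrix = A at *
  rw [Ne, hA.rank_eq_four_iff (z 0) (z 1) n01]
  have hB := hA.pivot (f 0) (f 1)
  have b22 : A.pivot (f 0) (f 1) (f 2) (f 2) = 0 := by simp [pivot_apply, z, z']
  have b33 : A.pivot (f 0) (f 1) (f 3) (f 3) = 0 := by simp [pivot_apply, z, z']
  have b44 : A.pivot (f 0) (f 1) (f 4) (f 4) = 0 := by simp [pivot_apply, z, z']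
  have b23 : A.pivot (f 0) (f 1) (f 2) (f 3) ≠ 0 := by simpa [pivot_apply, z, z'] using n23
  have b34 : A.pivot (f 0) (f 1) (f 3) (f 4) ≠ 0 := by simpa [pivot_apply, z, z'] using n34
  have b42 : A.pivot (f 0) (f 1) (f 4) (f 2) ≠ 0 := by
    simp [pivot_apply, z', n01, n12, n40]
  have b43 := hB.apply (f 3) (f 4)
  have b24 := hB.apply (f 4) (f 2)
  generalize A.pivot (f 0) (f 1) = B at *
  rw [hB.rank_eq_two_iff b22 b33 b23]
  intro h
  have h44 := h (f 4) (f 4)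
  rw [pivot_apply, b44, b43, b24] at h44
  have : (B (f 2) (f 3))⁻¹ * (2 * (B (f 4) (f 2) * B (f 3) (f 4))) = 0 := by
    linear_combination -h44
  simp [b23, b42, b34] at this

/-- Eliminating the edge 01 contracts the path 5, 0, 1, 2 to an edge 25 of weight -A 01 · A 12 · A
50. This extra minus sign turns the square condition around: the last entry, at (4,5), vanishes
exactly when the sign product is -1. -/
theorem rank_eq_four_iff_of_hexagon (hΓ : Γ.graph.IsUnicyclic)
    (hf : Γ.graph.IsCycleLabelling 6 f) : Γ.adjMatrix.rank = 4 ↔ ¬ Γ.IsBalanced := by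
  rw [isBalanced_iff_of_hexagon hΓ hf]
  have hadj := hf.adj_iff
  have hA := Γ.adjMatrix_isSymm
  have h01 : Γ.graph.Adj (f 0) (f 1) := (hadj 0 (by simp) 1 (by simp)).2 (by simp)
  have h12 : Γ.graph.Adj (f 1) (f 2) := (hadj 1 (by simp) 2 (by simp)).2 (by simp)
  have h23 : Γ.graph.Adj (f 2) (f 3) := (hadj 2 (by simp) 3 (by simp)).2 (by simp)
  have h34 : Γ.graph.Adj (f 3) (f 4) := (hadj 3 (by simp) 4 (by simp)).2 (by simp)
  have h45 : Γ.graph.Adj (f 4) (f 5) := (hadj 4 (by simp) 5 (by simp)).2 (by simp)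
  have h50 : Γ.graph.Adj (f 5) (f 0) := (hadj 5 (by simp) 0 (by simp)).2 (by simp)
  have n01 := Γ.adjMatrix_ne_zero_iff.2 h01
  have n23 := Γ.adjMatrix_ne_zero_iff.2 h23
  have n45 := Γ.adjMatrix_ne_zero_iff.2 h45
  have i01 := Γ.adjMatrix_inv h01
  have i23 := Γ.adjMatrix_inv h23
  have e01 := Γ.adjMatrix_mul_self h01
  have e12 := Γ.adjMatrix_mul_self h12
  have e23 := Γ.adjMatrix_mul_self h23
  have e34 := Γ.adjMatrix_mul_self h34
  have e45 := Γ.adjMatrix_mul_self h45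
  have e50 := Γ.adjMatrix_mul_self h50
  have z : ∀ i, Γ.adjMatrix (f i) (f i) = 0 := fun i => Γ.adjMatrix_self _
  have z' : ∀ i < 6, ∀ j < 6,
      ¬ (j = i + 1 ∨ i = j + 1 ∨ (i = 0 ∧ j + 1 = 6) ∨ (j = 0 ∧ i + 1 = 6)) →
      Γ.adjMatrix (f i) (f j) = 0 :=
    fun i hi j hj h => adjMatrix_eq_zero_of_isCycleLabelling hf hi hj h
  generalize Γ.adjMatrix = A at *
  rw [hA.rank_eq_four_iff (z 0) (z 1) n01]
  have hB := hA.pivot (f 0) (f 1)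
  have r0 := pivot_apply_fst_left (z 0) n01
  have r1 := hA.pivot_apply_snd_left (z 1) n01
  have b22 : A.pivot (f 0) (f 1) (f 2) (f 2) = 0 := by simp [pivot_apply, z, z']
  have b33 : A.pivot (f 0) (f 1) (f 3) (f 3) = 0 := by simp [pivot_apply, z, z']
  have b44 : A.pivot (f 0) (f 1) (f 4) (f 4) = 0 := by simp [pivot_apply, z, z']
  have b55 : A.pivot (f 0) (f 1) (f 5) (f 5) = 0 := by simp [pivot_apply, z, z']
  have b24 : A.pivot (f 0) (f 1) (f 2) (f 4) = 0 := by simp [pivot_apply, z']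
  have b35 : A.pivot (f 0) (f 1) (f 3) (f 5) = 0 := by simp [pivot_apply, z']
  have b23 : A.pivot (f 0) (f 1) (f 2) (f 3) = A (f 2) (f 3) := by simp [pivot_apply, z']
  have b34 : A.pivot (f 0) (f 1) (f 3) (f 4) = A (f 3) (f 4) := by simp [pivot_apply, z']
  have b45 : A.pivot (f 0) (f 1) (f 4) (f 5) = A (f 4) (f 5) := by simp [pivot_apply, z']
  have b25 : A.pivot (f 0) (f 1) (f 2) (f 5) =
      - (A (f 0) (f 1) * (A (f 1) (f 2) * A (f 5) (f 0))) := by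
    simp [pivot_apply, z', i01, hA.apply (f 1) (f 2), hA.apply (f 5) (f 0)]
  have b42 := hB.apply (f 2) (f 4)
  have b53 := hB.apply (f 3) (f 5)
  have b43 := hB.apply (f 3) (f 4)
  have n23' : A.pivot (f 0) (f 1) (f 2) (f 3) ≠ 0 := by rwa [b23]
  generalize A.pivot (f 0) (f 1) = B at *
  rw [hB.rank_eq_two_iff b22 b33 n23']
  have c45 : B.pivot (f 2) (f 3) (f 4) (f 5) = A (f 4) (f 5) + A (f 2) (f 3) * A (f 3) (f 4) *
      (A (f 0) (f 1) * (A (f 1) (f 2) * A (f 5) (f 0))) := by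
    rw [pivot_apply, b45, b42, b24, b43, b34, b25, b23, i23]
    ring
  constructor
  · intro h h1
    have h45 := h (f 4) (f 5)
    rw [c45] at h45
    have : (2 : ℝ) = 0 := by linear_combination (A (f 4) (f 5)) * h45 - e45 - h1
    norm_num at this
  · intro h
    have hsq : (A (f 0) (f 1) * A (f 1) (f 2) * A (f 2) (f 3) * A (f 3) (f 4) * A (f 4) (f 5) *
        A (f 5) (f 0)) * (A (f 0) (f 1) * A (f 1) (f 2) * A (f 2) (f 3) * A (f 3) (f 4) *
        A (f 4) (f 5) * A (f 5) (f 0)) = 1 := by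
      calc _ = (A (f 0) (f 1) * A (f 0) (f 1)) * (A (f 1) (f 2) * A (f 1) (f 2)) *
            (A (f 2) (f 3) * A (f 2) (f 3)) * (A (f 3) (f 4) * A (f 3) (f 4)) *
            (A (f 4) (f 5) * A (f 4) (f 5)) * (A (f 5) (f 0) * A (f 5) (f 0)) := by ring
        _ = 1 := by rw [e01, e12, e23, e34, e45, e50]; norm_num
    have hm := (mul_self_eq_one_iff.1 hsq).resolve_left h
    have c45' : B.pivot (f 2) (f 3) (f 4) (f 5) = 0 := by
      rw [c45]
      have : A (f 4) (f 5) * (A (f 4) (f 5) + A (f 2) (f 3) * A (f 3) (f 4) *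
        (A (f 0) (f 1) * (A (f 1) (f 2) * A (f 5) (f 0)))) = 0 := by
        linear_combination e45 + hm
      exact (mul_eq_zero.1 this).resolve_left n45
    have hC := hB.pivot (f 2) (f 3)
    have c54 := hC.apply (f 4) (f 5)
    have c44 : B.pivot (f 2) (f 3) (f 4) (f 4) = 0 := by
      rw [pivot_apply, b44, b42, b24]; ring
    have c55 : B.pivot (f 2) (f 3) (f 5) (f 5) = 0 := by
      rw [pivot_apply, b55, b35, b53, b35]; ring
    have s0 : ∀ u, B.pivot (f 2) (f 3) (f 0) u = 0 := pivot_apply_of_row_eq_zero r0 _ _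
    have s1 : ∀ u, B.pivot (f 2) (f 3) (f 1) u = 0 := pivot_apply_of_row_eq_zero r1 _ _
    have s2 := pivot_apply_fst_left b22 n23'
    have s3 := hB.pivot_apply_snd_left b33 n23'
    have t0 : ∀ u, B.pivot (f 2) (f 3) u (f 0) = 0 := fun u => by rw [hC.apply, s0]
    have t1 : ∀ u, B.pivot (f 2) (f 3) u (f 1) = 0 := fun u => by rw [hC.apply, s1]
    have t2 := hB.pivot_apply_fst_right b22 n23'
    have t3 := hB.pivot_apply_snd_right b33 n23'
    rw [c45'] at c54
    intro u v
    obtain ⟨i, hi, rfl⟩ := hf.surj u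
    obtain ⟨j, hj, rfl⟩ := hf.surj v
    interval_cases i <;> first | apply s0 | apply s1 | apply s2 | apply s3 | interval_cases j <;>
      first | apply t0 | apply t1 | apply t2 | apply t3 | assumption

/-- The edge 45 is untouched by eliminating 01 and then 23, so the second pivot is not zero. -/
theorem rank_ne_four_of_isCycleLabelling {m : ℕ} (hm : 7 ≤ m)
    (hf : Γ.graph.IsCycleLabelling m f) : Γ.adjMatrix.rank ≠ 4 := by
  have hadj := hf.adj_iff
  have hA := Γ.adjMatrix_isSymm
  have n01 := Γ.adjMatrix_ne_zero_iff.2 ((hadj 0 (by omega) 1 (by omega)).2 (by simp))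
  have n23 := Γ.adjMatrix_ne_zero_iff.2 ((hadj 2 (by omega) 3 (by omega)).2 (by simp))
  have n45 := Γ.adjMatrix_ne_zero_iff.2 ((hadj 4 (by omega) 5 (by omega)).2 (by simp))
  have z : ∀ i, Γ.adjMatrix (f i) (f i) = 0 := fun i => Γ.adjMatrix_self _
  -- Length at least 7 keeps 5 and 0 nonadjacent, so the first six vertices induce a path.
  have z' : ∀ i < 6, ∀ j < 6, ¬ (j = i + 1 ∨ i = j + 1) → Γ.adjMatrix (f i) (f j) = 0 :=
    fun i hi j hj h => adjMatrix_eq_zero_of_isCycleLabelling hf (by omega) (by omega) (by omega)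
  generalize Γ.adjMatrix = A at *
  rw [Ne, hA.rank_eq_four_iff (z 0) (z 1) n01]
  have hB := hA.pivot (f 0) (f 1)
  have b22 : A.pivot (f 0) (f 1) (f 2) (f 2) = 0 := by simp [pivot_apply, z, z']
  have b33 : A.pivot (f 0) (f 1) (f 3) (f 3) = 0 := by simp [pivot_apply, z, z']
  have b42 : A.pivot (f 0) (f 1) (f 4) (f 2) = 0 := by simp [pivot_apply, z']
  have b25 : A.pivot (f 0) (f 1) (f 2) (f 5) = 0 := by simp [pivot_apply, z']
  have b23 : A.pivot (f 0) (f 1) (f 2) (f 3) ≠ 0 := by simpa [pivot_apply, z, z'] using n23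
  have b45 : A.pivot (f 0) (f 1) (f 4) (f 5) = A (f 4) (f 5) := by simp [pivot_apply, z']
  generalize A.pivot (f 0) (f 1) = B at *
  rw [hB.rank_eq_two_iff b22 b33 b23]
  intro h
  have h45 := h (f 4) (f 5)
  rw [pivot_apply, b45, b42, b25] at h45
  apply n45
  linear_combination h45

end SignedGraph

/-! ### Combinatorics of the graphs with a pendant vertex -/

namespace SimpleGraph

variable {V : Type*} {G : SimpleGraph V}

/-- `w` is a pendant vertex attached at `y`. -/
def IsLeafAt (G : SimpleGraph V) (w y : V) : Prop :=
  ∀ u, G.Adj w u ↔ u = y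

theorem exists_isLeafAt_of_degree_eq_one {x : V} [Fintype (G.neighborSet x)]
    (h : G.degree x = 1) : ∃ y, G.IsLeafAt x y := by
  obtain ⟨y, hy⟩ := Finset.card_eq_one.1 h
  refine ⟨y, fun u => ?_⟩
  rw [← mem_neighborFinset, hy, Finset.mem_singleton]

/-- The triangle `a b c` with all further vertices pendant at `a` or `b`. -/
structure IsPendantTriangle (G : SimpleGraph V) (a b c : V) : Prop where
  adj_ab : G.Adj a b
  adj_bc : G.Adj b c
  adj_ca : G.Adj c a
  leaf : ∀ w, w ≠ a → w ≠ b → w ≠ c → G.IsLeafAt w a ∨ G.IsLeafAt w b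

/-- The induced square `a b c d`. -/
structure IsSquare (G : SimpleGraph V) (a b c d : V) : Prop where
  adj_ab : G.Adj a b
  adj_bc : G.Adj b c
  adj_cd : G.Adj c d
  adj_da : G.Adj d a
  ne_ac : a ≠ c
  ne_bd : b ≠ d
  not_adj_ac : ¬ G.Adj a c
  not_adj_bd : ¬ G.Adj b d

/-- The square `a b c d` with all further vertices pendant at `a` or `c`. -/
structure IsPendantSquare (G : SimpleGraph V) (a b c d : V) : Prop extends G.IsSquare a b c d where
  leaf : ∀ w, w ≠ a → w ≠ b → w ≠ c → w ≠ d → G.IsLeafAt w a ∨ G.IsLeafAt w c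

/-- The square `a b c d` with a further vertex `y` joined to `a` and all other vertices pendant
at `y`. -/
structure IsBroomSquare (G : SimpleGraph V) (a b c d y : V) : Prop extends
    G.IsSquare a b c d where
  adj_ya : G.Adj y a
  ne_yb : y ≠ b
  ne_yc : y ≠ c
  ne_yd : y ≠ d
  not_adj_yb : ¬ G.Adj y b
  not_adj_yc : ¬ G.Adj y c
  not_adj_yd : ¬ G.Adj y d
  leaf : ∀ w, w ≠ a → w ≠ b → w ≠ c → w ≠ d → w ≠ y → G.IsLeafAt w y

theorem IsPendantTriangle.symm {a b c : V} (h : G.IsPendantTriangle a b c) :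
    G.IsPendantTriangle b a c :=
  ⟨h.adj_ab.symm, h.adj_ca.symm, h.adj_bc.symm, fun w hb ha hc => (h.leaf w ha hb hc).symm⟩

theorem IsPendantSquare.symm {a b c d : V} (h : G.IsPendantSquare a b c d) :
    G.IsPendantSquare c b a d where
  adj_ab := h.adj_bc.symm
  adj_bc := h.adj_ab.symm
  adj_cd := h.adj_da.symm
  adj_da := h.adj_cd.symm
  ne_ac := h.ne_ac.symm
  ne_bd := h.ne_bd
  not_adj_ac h' := h.not_adj_ac h'.symm
  not_adj_bd := h.not_adj_bd
  leaf w hc hb ha hd := (h.leaf w ha hb hc hd).symm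

/-- Removing `y` leaves a complete bipartite graph with parts `P` and `Q` and isolated vertices
that are adjacent to `y`. -/
structure IsBicliqueApex (G : SimpleGraph V) (y : V) (P Q : Finset V) : Prop where
  notMem_left : y ∉ P
  notMem_right : y ∉ Q
  disj : Disjoint P Q
  left_nonempty : P.Nonempty
  right_nonempty : Q.Nonempty
  adj : ∀ u ∈ P, ∀ v ∈ Q, G.Adj u v
  not_adj_left : ∀ u ∈ P, ∀ v ∈ P, ¬ G.Adj u v
  not_adj_right : ∀ u ∈ Q, ∀ v ∈ Q, ¬ G.Adj u v
  leaf : ∀ w, w ≠ y → w ∉ P → w ∉ Q → G.IsLeafAt w y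

namespace IsBicliqueApex

variable {y : V} {P Q : Finset V}

theorem symm (h : G.IsBicliqueApex y P Q) : G.IsBicliqueApex y Q P :=
  ⟨h.notMem_right, h.notMem_left, h.disj.symm, h.right_nonempty, h.left_nonempty,
    fun u hu v hv => (h.adj v hv u hu).symm, h.not_adj_right, h.not_adj_left,
    fun w hy hQ hP => h.leaf w hy hP hQ⟩

variable [DecidableEq V] [DecidableRel G.Adj]

theorem degree_of_mem_left [Fintype V] (h : G.IsBicliqueApex y P Q) {u : V} (hu : u ∈ P) :
    G.degree u = Q.card + if G.Adj y u then 1 else 0 := by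
  have hN : G.neighborFinset u = Q ∪ if G.Adj y u then {y} else ∅ := by
    ext v
    rw [mem_neighborFinset, Finset.mem_union]
    constructor
    · intro huv
      by_cases hvy : v = y
      · subst hvy; right; simp [huv.symm]
      by_cases hvQ : v ∈ Q
      · exact .inl hvQ
      have hvP : v ∉ P := fun hvP => h.not_adj_left u hu v hvP huv
      have := (h.leaf v hvy hvP hvQ u).1 huv.symm
      exact absurd (this ▸ hu) h.notMem_left
    · rintro (hv | hv)
      · exact h.adj u hu v hv
      · split_ifs at hv with hyu
        · rw [Finset.mem_singleton.1 hv]; exact hyu.symm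
        · simp at hv
  rw [← card_neighborFinset_eq_degree, hN, Finset.card_union_of_disjoint]
  · split_ifs <;> simp
  · split_ifs <;> simp [h.notMem_right]

theorem sum_degree_left [Fintype V] (h : G.IsBicliqueApex y P Q) :
    ∑ u ∈ P, G.degree u = P.card * Q.card + (P.filter (G.Adj y)).card := by
  rw [Finset.sum_congr rfl fun u hu => h.degree_of_mem_left hu, Finset.sum_add_distrib,
    Finset.sum_const, smul_eq_mul, Finset.card_filter]

/-- Handshake lemma, halved. The pendant vertices at y cancel: each adds 1 to its own degree, 1 to
that of y, and 2 to twice the order. -/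
theorem card_filter_add_card_filter [Fintype V] (h : G.IsBicliqueApex y P Q) (hG : G.IsUnicyclic) :
    P.card * Q.card + ((P.filter (G.Adj y)).card + (Q.filter (G.Adj y)).card) =
      P.card + Q.card + 1 := by
  set R := Finset.univ.filter fun w => w ≠ y ∧ w ∉ P ∧ w ∉ Q with hR
  have hPQ := h.disj
  have hPQR : Disjoint (P ∪ Q) R := by
    rw [Finset.disjoint_left]
    intro w hw hw'
    simp [hR] at hw hw'
    tauto
  have hy : y ∉ P ∪ Q ∪ R := by simp [hR, h.notMem_left, h.notMem_right]
  have huniv : (Finset.univ : Finset V) = insert y (P ∪ Q ∪ R) := by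
    ext w
    simp [hR]
    tauto
  have hsum := hG.sum_degrees
  have hRdeg : ∑ w ∈ R, G.degree w = R.card := by
    rw [Finset.card_eq_sum_ones]
    refine Finset.sum_congr rfl fun w hw => ?_
    simp only [hR, Finset.mem_filter, Finset.mem_univ, true_and] at hw
    have hl := h.leaf w hw.1 hw.2.1 hw.2.2
    rw [← card_neighborFinset_eq_degree, Finset.card_eq_one]
    exact ⟨y, by ext u; simp [hl u]⟩
  have hydeg : G.degree y = (P.filter (G.Adj y)).card + (Q.filter (G.Adj y)).card + R.card := by
    have hN : G.neighborFinset y = P.filter (G.Adj y) ∪ Q.filter (G.Adj y) ∪ R := by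
      ext w
      simp only [mem_neighborFinset, Finset.mem_union, Finset.mem_filter, hR, Finset.mem_univ,
        true_and]
      constructor
      · intro hw
        have := hw.ne'
        tauto
      · rintro ((hw | hw) | hw)
        · exact hw.2
        · exact hw.2
        · exact ((h.leaf w hw.1 hw.2.1 hw.2.2 y).2 rfl).symm
    rw [← card_neighborFinset_eq_degree, hN, Finset.card_union_of_disjoint,
      Finset.card_union_of_disjoint]
    · exact hPQ.mono (Finset.filter_subset _ _) (Finset.filter_subset _ _)
    · exact hPQR.mono_left (Finset.union_subset_union (Finset.filter_subset _ _)
        (Finset.filter_subset _ _))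
  have hcard : Fintype.card V = P.card + Q.card + R.card + 1 := by
    rw [← Finset.card_univ, huniv, Finset.card_insert_of_notMem hy,
      Finset.card_union_of_disjoint hPQR, Finset.card_union_of_disjoint hPQ]
  rw [huniv, Finset.sum_insert hy, Finset.sum_union hPQR, Finset.sum_union hPQ, hRdeg, hydeg,
    h.sum_degree_left, h.symm.sum_degree_left, hcard, mul_comm Q.card] at hsum
  omega

/-- Otherwise P ∪ Q would be closed under adjacency without containing y. -/
theorem one_le_card_filter_add_card_filter (h : G.IsBicliqueApex y P Q) (hG : G.Preconnected) :
    1 ≤ (P.filter (G.Adj y)).card + (Q.filter (G.Adj y)).card := by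
  by_contra hlt
  have hP : P.filter (G.Adj y) = ∅ := Finset.card_eq_zero.1 (by omega)
  have hQ : Q.filter (G.Adj y) = ∅ := Finset.card_eq_zero.1 (by omega)
  rw [Finset.filter_eq_empty_iff] at hP hQ
  obtain ⟨u, hu⟩ := h.left_nonempty
  have := hG.mem_of_forall_adj {w | w ∈ P ∪ Q} ?_
    (by simp [hu] : u ∈ {w | w ∈ P ∪ Q}) y
  · simp [h.notMem_left, h.notMem_right] at this
  · intro w hw v hwv
    simp only [Set.mem_ofPred_eq, Finset.mem_union] at hw ⊢
    by_contra hv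
    push Not at hv
    by_cases hvy : v = y
    · subst hvy
      rcases hw with hw | hw
      · exact hP hw hwv.symm
      · exact hQ hw hwv.symm
    · have := (h.leaf v hvy hv.1 hv.2 w).1 hwv.symm
      subst this
      exact hw.elim h.notMem_left h.notMem_right

/-- Let P = {a}. Vertices of Q not adjacent to y are pendant at a. If y is adjacent to a, its other
neighbour in Q closes a triangle; if not, its two neighbours in Q close a square in which y and a
are opposite. -/
theorem exists_of_left_card_eq_one (h : G.IsBicliqueApex y P Q) (hP : P.card = 1)
    (hd : (P.filter (G.Adj y)).card + (Q.filter (G.Adj y)).card = 2) :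
    (∃ a b c, G.IsPendantTriangle a b c) ∨ ∃ a b c d, G.IsPendantSquare a b c d := by
  obtain ⟨a, rfl⟩ := Finset.card_eq_one.1 hP
  have ha : a ∈ ({a} : Finset V) := Finset.mem_singleton_self a
  have hya : y ≠ a := by simpa using h.notMem_left
  have hleaf : ∀ w ∈ Q, ¬ G.Adj y w → G.IsLeafAt w a := by
    intro w hw hyw u
    constructor
    · intro hwu
      by_contra hua
      by_cases huy : u = y
      · exact hyw (huy ▸ hwu.symm)
      by_cases huQ : u ∈ Q
      · exact h.not_adj_right w hw u huQ hwu
      · have := (h.leaf u huy (by simpa using hua) huQ w).1 hwu.symm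
        exact h.notMem_right (this ▸ hw)
    · rintro rfl
      exact (h.adj u ha w hw).symm
  by_cases hadj : G.Adj y a
  · left
    rw [Finset.filter_singleton, if_pos hadj, Finset.card_singleton] at hd
    obtain ⟨v, hv⟩ := Finset.card_eq_one.1 (by omega : (Q.filter (G.Adj y)).card = 1)
    have hmem : ∀ w, w ∈ Q ∧ G.Adj y w ↔ w = v := by
      intro w
      rw [← Finset.mem_filter, hv, Finset.mem_singleton]
    obtain ⟨hvQ, hyv⟩ := (hmem v).2 rfl
    refine ⟨y, a, v, hadj, h.adj a ha v hvQ, hyv.symm, fun w hwy hwa hwv => ?_⟩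
    by_cases hwQ : w ∈ Q
    · exact .inr (hleaf w hwQ fun hyw => hwv ((hmem w).1 ⟨hwQ, hyw⟩))
    · exact .inl (h.leaf w hwy (by simpa using hwa) hwQ)
  · right
    rw [Finset.filter_singleton, if_neg hadj, Finset.card_empty, zero_add] at hd
    obtain ⟨u, v, huv, hQ⟩ := Finset.card_eq_two.1 hd
    have hmem : ∀ w, w ∈ Q ∧ G.Adj y w ↔ w = u ∨ w = v := by
      intro w
      rw [← Finset.mem_filter, hQ, Finset.mem_insert, Finset.mem_singleton]
    obtain ⟨huQ, hyu⟩ := (hmem u).2 (.inl rfl)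
    obtain ⟨hvQ, hyv⟩ := (hmem v).2 (.inr rfl)
    refine ⟨y, u, a, v, ⟨hyu, (h.adj a ha u huQ).symm, h.adj a ha v hvQ, hyv.symm, hya, huv, hadj,
      h.not_adj_right u huQ v hvQ⟩, fun w hwy hwu hwa hwv => ?_⟩
    by_cases hwQ : w ∈ Q
    · exact .inr (hleaf w hwQ fun hyw => ((hmem w).1 ⟨hwQ, hyw⟩).elim hwu hwv)
    · exact .inl (h.leaf w hwy (by simpa using hwa) hwQ)

theorem exists_isBroomSquare (h : G.IsBicliqueApex y P Q) (hP : P.card = 2) (hQ : Q.card = 2)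
    (hdP : (P.filter (G.Adj y)).card = 1) (hdQ : (Q.filter (G.Adj y)).card = 0) :
    ∃ a ∈ P, ∃ b ∈ Q, ∃ c ∈ P, ∃ d ∈ Q, G.IsBroomSquare a b c d y := by
  obtain ⟨a, ha⟩ := Finset.card_eq_one.1 hdP
  have hmem : ∀ w, w ∈ P ∧ G.Adj y w ↔ w = a := by
    intro w
    rw [← Finset.mem_filter, ha, Finset.mem_singleton]
  have hQy : ∀ w ∈ Q, ¬ G.Adj y w := by
    rw [Finset.card_eq_zero, Finset.filter_eq_empty_iff] at hdQ
    exact fun w hw => hdQ hw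
  obtain ⟨haP, hya⟩ := (hmem a).2 rfl
  obtain ⟨c, hc⟩ := Finset.card_eq_one.1
    (by rw [Finset.card_erase_of_mem haP, hP] : (P.erase a).card = 1)
  have hcP : c ∈ P ∧ c ≠ a := by
    have : c ∈ P.erase a := by simp [hc]
    simpa [and_comm] using this
  obtain ⟨b, d, hbd, rfl⟩ := Finset.card_eq_two.1 hQ
  have hb : b ∈ ({b, d} : Finset V) := by simp
  have hd : d ∈ ({b, d} : Finset V) := by simp
  refine ⟨a, haP, b, hb, c, hcP.1, d, hd,
    ⟨h.adj a haP b hb, (h.adj c hcP.1 b hb).symm, h.adj c hcP.1 d hd, (h.adj a haP d hd).symm,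
      hcP.2.symm, hbd, h.not_adj_left a haP c hcP.1, h.not_adj_right b hb d hd⟩,
    hya, ?_, ?_, ?_, hQy b hb, fun hyc => hcP.2 ((hmem c).1 ⟨hcP.1, hyc⟩), hQy d hd, ?_⟩
  · rintro rfl; exact h.notMem_right hb
  · rintro rfl; exact h.notMem_left hcP.1
  · rintro rfl; exact h.notMem_right hd
  · intro w hwa hwb hwc hwd hwy
    refine h.leaf w hwy (fun hwP => ?_) (by simp [hwb, hwd])
    have : w ∈ P.erase a := by simp [hwa, hwP]
    rw [hc, Finset.mem_singleton] at this
    exact hwc this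

theorem classification [Fintype V] (h : G.IsBicliqueApex y P Q) (hG : G.IsUnicyclic) :
    (∃ a b c, G.IsPendantTriangle a b c) ∨ (∃ a b c d, G.IsPendantSquare a b c d) ∨
      (∃ a ∈ P, ∃ b ∈ Q, ∃ c ∈ P, ∃ d ∈ Q, G.IsBroomSquare a b c d y) ∨
      ∃ a ∈ Q, ∃ b ∈ P, ∃ c ∈ Q, ∃ d ∈ P, G.IsBroomSquare a b c d y := by
  have hd := h.one_le_card_filter_add_card_filter hG.1.preconnected
  have hc := h.card_filter_add_card_filter hG
  have hp := h.left_nonempty.card_pos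
  have hq := h.right_nonempty.card_pos
  by_cases hP : P.card = 1
  · rw [hP] at hc
    rcases h.exists_of_left_card_eq_one hP (by omega) with h | h
    · exact .inl h
    · exact .inr (.inl h)
  by_cases hQ : Q.card = 1
  · rw [hQ] at hc
    rcases h.symm.exists_of_left_card_eq_one hQ (by omega) with h | h
    · exact .inl h
    · exact .inr (.inl h)
  obtain ⟨p, hp'⟩ : ∃ p, P.card = p + 2 := ⟨P.card - 2, by omega⟩
  obtain ⟨q, hq'⟩ : ∃ q, Q.card = q + 2 := ⟨Q.card - 2, by omega⟩
  rw [hp', hq'] at hc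
  -- With `p * q` as an atom, the count reads p q + p + q + d = 1, and d ≥ 1 forces p = q = 0.
  have hexp : (p + 2) * (q + 2) = p * q + 2 * p + 2 * q + 4 := by ring
  have hp0 : p = 0 := by omega
  have hq0 : q = 0 := by omega
  subst hp0 hq0
  by_cases hdP : (P.filter (G.Adj y)).card = 1
  · exact .inr (.inr (.inl (h.exists_isBroomSquare hp' hq' hdP (by omega))))
  · exact .inr (.inr (.inr (h.symm.exists_isBroomSquare hq' hp' (by omega) (by omega))))

end IsBicliqueApex

end SimpleGraph

/-! ### Rank four in the presence of a pendant vertex -/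

namespace SignedGraph

open Matrix

variable {V : Type*} {Γ : SignedGraph V} {x y : V}

/-- The row of x is zero outside column y, so the correction terms vanish: pivoting on a pendant
edge is deletion of its two ends. -/
theorem pivot_apply_of_isLeafAt (h : Γ.graph.IsLeafAt x y) {u v : V} (huy : u ≠ y) (hvy : v ≠ y) :
    Γ.adjMatrix.pivot x y u v = Γ.adjMatrix u v := by
  have h1 : Γ.adjMatrix u x = 0 := by
    rw [Γ.adjMatrix_comm, Γ.adjMatrix_eq_zero_iff, h u]; exact huy
  have h2 : Γ.adjMatrix x v = 0 := by
    rw [Γ.adjMatrix_eq_zero_iff, h v]; exact hvy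
  rw [pivot_apply, h1, h2]
  ring

theorem adjMatrix_ne_zero_of_isLeafAt (h : Γ.graph.IsLeafAt x y) : Γ.adjMatrix x y ≠ 0 :=
  Γ.adjMatrix_ne_zero_iff.2 ((h y).2 rfl)

theorem pivot_self_of_isLeafAt (h : Γ.graph.IsLeafAt x y) (u : V) :
    Γ.adjMatrix.pivot x y u u = 0 := by
  have hn := adjMatrix_ne_zero_of_isLeafAt h
  by_cases hux : u = x
  · rw [hux, pivot_apply_fst_left (Γ.adjMatrix_self x) hn]
  by_cases huy : u = y
  · rw [huy, Γ.adjMatrix_isSymm.pivot_apply_snd_left (Γ.adjMatrix_self y) hn]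
  rw [pivot_apply_of_isLeafAt h huy huy, Γ.adjMatrix_self]

theorem pivot_ne_zero_iff_of_isLeafAt (h : Γ.graph.IsLeafAt x y) {u v : V} :
    Γ.adjMatrix.pivot x y u v ≠ 0 ↔
      (u ≠ x ∧ u ≠ y) ∧ (v ≠ x ∧ v ≠ y) ∧ Γ.graph.Adj u v := by
  have hA := Γ.adjMatrix_isSymm
  have hn := adjMatrix_ne_zero_of_isLeafAt h
  by_cases hux : u = x
  · simp [hux, pivot_apply_fst_left (Γ.adjMatrix_self x) hn]
  by_cases huy : u = y
  · simp [huy, hA.pivot_apply_snd_left (Γ.adjMatrix_self y) hn]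
  by_cases hvx : v = x
  · simp [hvx, hA.pivot_apply_fst_right (Γ.adjMatrix_self x) hn]
  by_cases hvy : v = y
  · simp [hvy, hA.pivot_apply_snd_right (Γ.adjMatrix_self y) hn]
  rw [pivot_apply_of_isLeafAt h huy hvy, Γ.adjMatrix_ne_zero_iff]
  tauto

variable [Fintype V] [DecidableEq V]

theorem rank_eq_four_iff_of_isLeafAt (h : Γ.graph.IsLeafAt x y) :
    Γ.adjMatrix.rank = 4 ↔ (Γ.adjMatrix.pivot x y).rank = 2 :=
  Γ.adjMatrix_isSymm.rank_eq_four_iff (Γ.adjMatrix_self x) (Γ.adjMatrix_self y)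
    (adjMatrix_ne_zero_of_isLeafAt h)

theorem rank_eq_four_iff_pivot_pivot_of_isLeafAt (h : Γ.graph.IsLeafAt x y) {a b : V}
    (ha : a ≠ x ∧ a ≠ y) (hb : b ≠ x ∧ b ≠ y) (hab : Γ.graph.Adj a b) :
    Γ.adjMatrix.rank = 4 ↔ ∀ u v, (Γ.adjMatrix.pivot x y).pivot a b u v = 0 := by
  rw [rank_eq_four_iff_of_isLeafAt h]
  exact (Γ.adjMatrix_isSymm.pivot x y).rank_eq_two_iff (pivot_self_of_isLeafAt h a)
    (pivot_self_of_isLeafAt h b) ((pivot_ne_zero_iff_of_isLeafAt h).2 ⟨ha, hb, hab⟩)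

/-- Vanishing of the second pivot expresses every entry of B through the columns of a and b. On the
diagonal this shows that no vertex is adjacent to both; off it, that neighbours of b are joined
precisely to neighbours of a, with entries that are products of a factor for each end. In a 4-cycle
every factor occurs twice, whence the sign condition. -/
theorem exists_isBicliqueApex (hG : Γ.graph.Preconnected) (h : Γ.graph.IsLeafAt x y)
    (hr : Γ.adjMatrix.rank = 4) :
    ∃ P Q : Finset V, Γ.graph.IsBicliqueApex y P Q ∧ ∀ u ∈ P, ∀ v ∈ Q, ∀ u' ∈ P, ∀ v' ∈ Q,
      Γ.adjMatrix u v * Γ.adjMatrix v u' * Γ.adjMatrix u' v' * Γ.adjMatrix v' u = 1 := by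
  classical
  have hB := Γ.adjMatrix_isSymm.pivot x y
  have hne := fun u v => pivot_ne_zero_iff_of_isLeafAt h (u := u) (v := v)
  obtain ⟨a, b, hab0⟩ : ∃ a b, Γ.adjMatrix.pivot x y a b ≠ 0 := by
    by_contra! h0
    have : Γ.adjMatrix.pivot x y = 0 := by ext u v; exact h0 u v
    rw [rank_eq_four_iff_of_isLeafAt h, this, Matrix.rank_zero] at hr
    omega
  obtain ⟨ha, hb, hab⟩ := (hne a b).1 hab0
  rw [rank_eq_four_iff_pivot_pivot_of_isLeafAt h ha hb hab] at hr
  have hself := pivot_self_of_isLeafAt h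
  have hval : ∀ u v, Γ.adjMatrix.pivot x y u v ≠ 0 →
      Γ.adjMatrix.pivot x y u v = Γ.adjMatrix u v := by
    intro u v huv
    obtain ⟨hu, hv, -⟩ := (hne u v).1 huv
    exact pivot_apply_of_isLeafAt h hu.2 hv.2
  generalize Γ.adjMatrix.pivot x y = B at *
  have hform : ∀ u v, B u v = (B a b)⁻¹ * (B u a * B b v + B u b * B a v) := by
    intro u v
    have := hr u v
    rw [pivot_apply] at this
    linear_combination this
  have hsym : ∀ u v, B u v = B v u := fun u v => hB.apply v u
  have hdisj : ∀ u, B u b ≠ 0 → B u a = 0 := by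
    intro u hub
    by_contra hua
    have := hform u u
    rw [hself, hsym b u, hsym a u] at this
    have h2 : (B a b)⁻¹ * (2 * (B u a * B u b)) = 0 := by linear_combination -this
    simp [hab0, hub, hua] at h2
  have hdisj' : ∀ u, B u a ≠ 0 → B u b = 0 := by
    intro u hua
    by_contra hub
    exact hua (hdisj u hub)
  have hadj : ∀ u v, B u b ≠ 0 → B v a ≠ 0 → B u v = (B a b)⁻¹ * (B u b * B v a) := by
    intro u v hu hv
    rw [hform u v, hdisj u hu, hsym a v]
    ring
  have hadj' : ∀ u v, B u b ≠ 0 → B v a ≠ 0 → B u v ≠ 0 := by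
    intro u v hu hv
    rw [hadj u v hu hv]
    simp [hab0, hu, hv]
  -- P consists of the neighbours of b, so it contains a; Q of those of a, so it contains b.
  refine ⟨Finset.univ.filter fun u => B u b ≠ 0, Finset.univ.filter fun u => B u a ≠ 0,
    ⟨?_, ?_, ?_, ?_, ?_, ?_, ?_, ?_, ?_⟩, ?_⟩ <;>
    try simp only [Finset.mem_filter, Finset.mem_univ, true_and, Finset.disjoint_left]
  · exact fun hy => ((hne _ _).1 hy).1.2 rfl
  · exact fun hy => ((hne _ _).1 hy).1.2 rfl
  · exact fun u hu hu' => hu' (hdisj u hu)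
  · exact ⟨a, by simpa using hab0⟩
  · exact ⟨b, by simpa [hsym b a] using hab0⟩
  · exact fun u hu v hv => ((hne u v).1 (hadj' u v hu hv)).2.2
  · intro u hu v hv huv
    refine (hne u v).2 ⟨((hne _ _).1 hu).1, ((hne _ _).1 hv).1, huv⟩ ?_
    rw [hform, hdisj u hu, hsym a v, hdisj v hv]
    ring
  · intro u hu v hv huv
    refine (hne u v).2 ⟨((hne _ _).1 hu).1, ((hne _ _).1 hv).1, huv⟩ ?_
    rw [hform, hdisj' u hu, hsym b v, hdisj' v hv]
    ring
  · intro w hwy hwb hwa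
    by_cases hwx : w = x
    · rw [hwx]; exact h
    push Not at hwb hwa
    have hN : ∀ v, Γ.graph.Adj w v → v = y := by
      intro v hwv
      by_contra hvy
      by_cases hvx : v = x
      · exact hwy ((h w).1 (hvx ▸ hwv.symm))
      · refine (hne w v).2 ⟨⟨hwx, hwy⟩, ⟨hvx, hvy⟩, hwv⟩ ?_
        rw [hform, hwa, hwb]
        ring
    refine fun v => ⟨hN v, ?_⟩
    rintro rfl
    -- All neighbours of w equal y, and connectedness provides at least one.
    have : Nontrivial V := ⟨w, v, hwy⟩
    obtain ⟨v', hv'⟩ := hG.exists_adj_of_nontrivial w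
    exact hN v' hv' ▸ hv'
  · intro u hu v hv u' hu' v' hv'
    have key : ∀ u v, B u b ≠ 0 → B v a ≠ 0 →
        Γ.adjMatrix u v = Γ.adjMatrix a b * (Γ.adjMatrix u b * Γ.adjMatrix v a) := by
      intro u v hu hv
      rw [← hval u v (hadj' u v hu hv), ← hval u b hu, ← hval v a hv, hadj u v hu hv,
        hval a b hab0, Γ.adjMatrix_inv hab]
    have sq : ∀ u v, B u v ≠ 0 → Γ.adjMatrix u v * Γ.adjMatrix u v = 1 :=
      fun u v huv => Γ.adjMatrix_mul_self ((hne u v).1 huv).2.2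
    rw [Γ.adjMatrix_comm v u', Γ.adjMatrix_comm v' u, key u v hu hv, key u' v hu' hv,
      key u' v' hu' hv', key u v' hu hv']
    calc _ = (Γ.adjMatrix a b * Γ.adjMatrix a b) * (Γ.adjMatrix a b * Γ.adjMatrix a b) *
          (Γ.adjMatrix u b * Γ.adjMatrix u b) * (Γ.adjMatrix u' b * Γ.adjMatrix u' b) *
          (Γ.adjMatrix v a * Γ.adjMatrix v a) * (Γ.adjMatrix v' a * Γ.adjMatrix v' a) := by ring
      _ = 1 := by rw [sq a b hab0, sq u b hu, sq u' b hu', sq v a hv, sq v' a hv']; norm_num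

/-- Deleting x and y leaves a star centred at c with isolated vertices, whose matrix has rank 2 for
any signs. -/
theorem rank_eq_four_of_isLeafAt_of_star (h : Γ.graph.IsLeafAt x y) {c b : V}
    (hc : c ≠ x ∧ c ≠ y) (hb : b ≠ x ∧ b ≠ y) (hcb : Γ.graph.Adj c b)
    (hstar : ∀ u v, u ≠ y → v ≠ y → u ≠ x → Γ.graph.Adj u v → u = c ∨ v = c) :
    Γ.adjMatrix.rank = 4 := by
  rw [rank_eq_four_iff_pivot_pivot_of_isLeafAt h hc hb hcb]
  have hB := Γ.adjMatrix_isSymm.pivot x y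
  have hself := pivot_self_of_isLeafAt h
  have hn := (pivot_ne_zero_iff_of_isLeafAt h).2 ⟨hc, hb, hcb⟩
  have hz : ∀ u v, u ≠ c → v ≠ c → Γ.adjMatrix.pivot x y u v = 0 := by
    intro u v hu hv
    by_contra huv
    obtain ⟨hu', hv', hadj⟩ := (pivot_ne_zero_iff_of_isLeafAt h).1 huv
    exact (hstar u v hu'.2 hv'.2 hu'.1 hadj).elim hu hv
  intro u v
  by_cases hu : u = c
  · rw [hu]; exact pivot_apply_fst_left (hself c) hn v
  by_cases hv : v = c
  · rw [hv]; exact hB.pivot_apply_fst_right (hself c) hn u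
  rw [pivot_apply, hz u v hu hv, hz u b hu hcb.ne', hz b v hcb.ne' hv]
  ring

theorem rank_eq_four_of_isPendantTriangle {a b c : V} (h : Γ.graph.IsPendantTriangle a b c)
    (hV : ∃ w, w ≠ a ∧ w ≠ b ∧ w ≠ c) : Γ.adjMatrix.rank = 4 := by
  obtain ⟨x, hxa, hxb, hxc⟩ := hV
  -- By symmetry the pendant vertex is at a. Deleting it and a leaves a star centred at b.
  wlog hx : Γ.graph.IsLeafAt x a generalizing a b
  · exact this h.symm hxb hxa ((h.leaf x hxa hxb hxc).resolve_left hx)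
  refine rank_eq_four_of_isLeafAt_of_star hx (c := b) (b := c) ⟨hxb.symm, h.adj_ab.ne'⟩
    ⟨hxc.symm, h.adj_ca.ne⟩ h.adj_bc ?_
  intro u v hua hva hux huv
  by_contra! hne
  by_cases huc : u = c
  · have hvc : v ≠ c := fun hvc => huv.ne (huc.trans hvc.symm)
    rcases h.leaf v hva hne.2 hvc with hl | hl
    · exact hua ((hl u).1 huv.symm)
    · exact hne.1 ((hl u).1 huv.symm)
  · rcases h.leaf u hua hne.1 huc with hl | hl
    · exact hva ((hl v).1 huv)
    · exact hne.2 ((hl v).1 huv)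

theorem rank_eq_four_of_isPendantSquare {a b c d : V} (h : Γ.graph.IsPendantSquare a b c d)
    (hV : ∃ w, w ≠ a ∧ w ≠ b ∧ w ≠ c ∧ w ≠ d) : Γ.adjMatrix.rank = 4 := by
  obtain ⟨x, hxa, hxb, hxc, hxd⟩ := hV
  -- Deleting x and a destroys the square and leaves a star centred at the opposite vertex c.
  wlog hx : Γ.graph.IsLeafAt x a generalizing a c
  · exact this h.symm hxc hxa ((h.leaf x hxa hxb hxc hxd).resolve_left hx)
  refine rank_eq_four_of_isLeafAt_of_star hx (c := c) (b := b) ⟨hxc.symm, h.ne_ac.symm⟩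
    ⟨hxb.symm, h.adj_ab.ne'⟩ h.adj_bc.symm ?_
  intro u v hua hva hux huv
  by_contra! hne
  have hleaf : ∀ w z, w ≠ a → w ≠ c → z ≠ a → z ≠ c → Γ.graph.Adj w z → w = b ∨ w = d := by
    intro w z hwa hwc hza hzc hwz
    by_contra! hw
    rcases h.leaf w hwa hw.1 hwc hw.2 with hl | hl
    · exact hza ((hl z).1 hwz)
    · exact hzc ((hl z).1 hwz)
  rcases hleaf u v hua hne.1 hva hne.2 huv with rfl | rfl <;>
    rcases hleaf v _ hva hne.2 hua hne.1 huv.symm with rfl | rfl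
  · exact huv.ne rfl
  · exact h.not_adj_bd huv
  · exact h.not_adj_bd huv.symm
  · exact huv.ne rfl

/-- Deleting y and a pendant vertex leaves the square intact, so here the signs matter: after
eliminating ab, the entry at (c,d) vanishes because the square is positive. -/
theorem rank_eq_four_of_isBroomSquare (hΓ : Γ.graph.IsUnicyclic) {a b c d y : V}
    (h : Γ.graph.IsBroomSquare a b c d y)
    (hV : ∃ w, w ≠ a ∧ w ≠ b ∧ w ≠ c ∧ w ≠ d ∧ w ≠ y) (hbal : Γ.IsBalanced) :
    Γ.adjMatrix.rank = 4 := by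
  obtain ⟨x, hxa, hxb, hxc, hxd, hxy⟩ := hV
  have hx := h.leaf x hxa hxb hxc hxd hxy
  rw [isBalanced_iff_of_square hΓ h.adj_ab h.adj_bc h.adj_cd h.adj_da h.ne_ac h.ne_bd] at hbal
  have ha : a ≠ x ∧ a ≠ y := ⟨hxa.symm, h.adj_ya.ne'⟩
  have hb : b ≠ x ∧ b ≠ y := ⟨hxb.symm, h.ne_yb.symm⟩
  rw [rank_eq_four_iff_pivot_pivot_of_isLeafAt hx ha hb h.adj_ab]
  have hB := Γ.adjMatrix_isSymm.pivot x y
  have hself := pivot_self_of_isLeafAt hx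
  have hne := fun u v => pivot_ne_zero_iff_of_isLeafAt hx (u := u) (v := v)
  have hn := (hne a b).2 ⟨ha, hb, h.adj_ab⟩
  have hval : ∀ u v, u ≠ y → v ≠ y → Γ.adjMatrix.pivot x y u v = Γ.adjMatrix u v :=
    fun u v h1 h2 => pivot_apply_of_isLeafAt hx h1 h2
  have hrow : ∀ u, u ≠ a → u ≠ b → u ≠ c → u ≠ d → ∀ v, Γ.adjMatrix.pivot x y u v = 0 := by
    intro u hua hub huc hud v
    by_contra huv
    obtain ⟨hu, hv, hadj⟩ := (hne u v).1 huv
    exact hv.2 ((h.leaf u hua hub huc hud hu.2 v).1 hadj)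
  have hac : Γ.adjMatrix.pivot x y a c = 0 := by
    by_contra h'
    exact h.not_adj_ac ((hne _ _).1 h').2.2
  have hbd : Γ.adjMatrix.pivot x y b d = 0 := by
    by_contra h'
    exact h.not_adj_bd ((hne _ _).1 h').2.2
  have vab := hval a b ha.2 hb.2
  have vad := hval a d ha.2 h.ne_yd.symm
  have vcb := hval c b h.ne_yc.symm hb.2
  have vcd := hval c d h.ne_yc.symm h.ne_yd.symm
  have hC := hB.pivot a b
  have hcd : (Γ.adjMatrix.pivot x y).pivot a b c d = 0 := by
    rw [pivot_apply, hB.apply a c, hac, vab, vad, vcb, vcd, Γ.adjMatrix_inv h.adj_ab,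
      Γ.adjMatrix_comm c b, Γ.adjMatrix_comm a d]
    have e := Γ.adjMatrix_mul_self h.adj_cd
    linear_combination (-Γ.adjMatrix c d) * hbal +
      (Γ.adjMatrix a b * Γ.adjMatrix b c * Γ.adjMatrix d a) * e
  intro u v
  by_cases hua : u = a
  · rw [hua]; exact pivot_apply_fst_left (hself a) hn v
  by_cases hub : u = b
  · rw [hub]; exact hB.pivot_apply_snd_left (hself b) hn v
  by_cases hva : v = a
  · rw [hva]; exact hB.pivot_apply_fst_right (hself a) hn u
  by_cases hvb : v = b
  · rw [hvb]; exact hB.pivot_apply_snd_right (hself b) hn u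
  by_cases hu : u = c ∨ u = d
  · by_cases hv : v = c ∨ v = d
    · rcases hu with hu | hu <;> rcases hv with hv | hv <;> rw [hu, hv]
      · rw [pivot_apply, hself, hB.apply a c, hac]; ring
      · exact hcd
      · rw [hC.apply]; exact hcd
      · rw [pivot_apply, hself, hB.apply b d, hbd]; ring
    · push Not at hv
      rw [hC.apply]
      exact pivot_apply_of_row_eq_zero (hrow v hva hvb hv.1 hv.2) _ _ _
  · push Not at hu
    exact pivot_apply_of_row_eq_zero (hrow u hua hub hu.1 hu.2) _ _ _

end SignedGraph

/-! ### Isomorphisms with the named graphs -/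

namespace SimpleGraph

variable {V : Type*} {G : SimpleGraph V}

theorem cycleGraph_four_adj (i j : Fin 4) : (cycleGraph 4).Adj i j ↔ j = i + 1 ∨ i = j + 1 := by
  revert i j; decide

theorem cycleGraph_three_adj (i j : Fin 3) : (cycleGraph 3).Adj i j ↔ i ≠ j := by
  simp [cycleGraph_three_eq_top]

theorem IsCycleLabelling.nonempty_iso {m : ℕ} {f : ℕ → V} (h : G.IsCycleLabelling m f)
    (hadj : ∀ i j : Fin m, (cycleGraph m).Adj i j ↔ (j.1 = i.1 + 1 ∨ i.1 = j.1 + 1 ∨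
      (i.1 = 0 ∧ j.1 + 1 = m) ∨ (j.1 = 0 ∧ i.1 + 1 = m))) :
    Nonempty (G ≃g cycleGraph m) := by
  have hbij : Function.Bijective fun i : Fin m => f i :=
    ⟨fun i j hij => Fin.ext (h.inj _ i.2 _ j.2 hij), fun v => by
      obtain ⟨i, hi, hv⟩ := h.surj v
      exact ⟨⟨i, hi⟩, hv⟩⟩
  refine ⟨(RelIso.symm ⟨Equiv.ofBijective _ hbij, fun {i j} => ?_⟩)⟩
  rw [hadj]
  exact h.adj_iff _ i.2 _ j.2

theorem exists_isCycleLabelling_of_iso {m : ℕ} [NeZero m] (φ : G ≃g cycleGraph m)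
    (hadj : ∀ i j : Fin m, (cycleGraph m).Adj i j ↔ (j.1 = i.1 + 1 ∨ i.1 = j.1 + 1 ∨
      (i.1 = 0 ∧ j.1 + 1 = m) ∨ (j.1 = 0 ∧ i.1 + 1 = m))) :
    ∃ f, G.IsCycleLabelling m f := by
  refine ⟨fun i => φ.symm (Fin.ofNat m i), fun v => ⟨φ v, (φ v).2, by simp⟩, ?_, ?_⟩
  · intro i hi j hj hij
    have := congrArg Fin.val (φ.symm.injective hij)
    simpa [Nat.mod_eq_of_lt hi, Nat.mod_eq_of_lt hj] using this
  · intro i hi j hj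
    rw [φ.symm.map_adj_iff, hadj]
    simp [Nat.mod_eq_of_lt hi, Nat.mod_eq_of_lt hj]

theorem cycleGraph_four_adj_val (i j : Fin 4) : (cycleGraph 4).Adj i j ↔
    (j.1 = i.1 + 1 ∨ i.1 = j.1 + 1 ∨ (i.1 = 0 ∧ j.1 + 1 = 4) ∨ (j.1 = 0 ∧ i.1 + 1 = 4)) := by
  revert i j; decide

theorem cycleGraph_six_adj_val (i j : Fin 6) : (cycleGraph 6).Adj i j ↔
    (j.1 = i.1 + 1 ∨ i.1 = j.1 + 1 ∨ (i.1 = 0 ∧ j.1 + 1 = 6) ∨ (j.1 = 0 ∧ i.1 + 1 = 6)) := by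
  revert i j; decide

theorem not_isLeafAt_of_adj_of_adj {v u w : V} (hu : G.Adj v u) (hw : G.Adj v w) (h : u ≠ w)
    (z : V) : ¬ G.IsLeafAt v z :=
  fun hl => h (((hl u).1 hu).trans ((hl w).1 hw).symm)

/-- Common source of the isomorphisms with U₁ and U₂: `g` embeds the core as an induced subgraph,
and the numbers of pendant edges are the numbers of leaves at the two attachment vertices. No core
vertex is a leaf and no vertex is a leaf at both, so nothing is counted twice. -/
theorem nonempty_iso_attachPendants [Finite V] {W : Type*} {H : SimpleGraph W} {g : W → V}
    (hg : Function.Injective g) (hH : ∀ i j, G.Adj (g i) (g j) ↔ H.Adj i j)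
    (hng : ∀ i z, ¬ G.IsLeafAt (g i) z) {i₀ i₁ : W} (hi : i₀ ≠ i₁)
    (hleaf : ∀ v, v ∉ Set.range g → G.IsLeafAt v (g i₀) ∨ G.IsLeafAt v (g i₁)) :
    Nonempty (G ≃g H.attachPendants
      (Sum.elim (fun _ : Fin (Nat.card {v // G.IsLeafAt v (g i₀)}) => i₀)
        (fun _ : Fin (Nat.card {v // G.IsLeafAt v (g i₁)}) => i₁))) := by
  let e₀ := (Finite.equivFin {v // G.IsLeafAt v (g i₀)}).symm
  let e₁ := (Finite.equivFin {v // G.IsLeafAt v (g i₁)}).symm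
  let φ : W ⊕ (Fin (Nat.card {v // G.IsLeafAt v (g i₀)}) ⊕
      Fin (Nat.card {v // G.IsLeafAt v (g i₁)})) → V :=
    Sum.elim g (Sum.elim (fun k => (e₀ k).1) fun k => (e₁ k).1)
  have n0 : ∀ k i, (e₀ k).1 ≠ g i := fun k i h => hng i _ (h ▸ (e₀ k).2)
  have n1 : ∀ k i, (e₁ k).1 ≠ g i := fun k i h => hng i _ (h ▸ (e₁ k).2)
  have hinj : Function.Injective φ := by
    refine Function.Injective.sumElim hg (Function.Injective.sumElim
      (Subtype.val_injective.comp e₀.injective) (Subtype.val_injective.comp e₁.injective) ?_) ?_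
    · intro k l hkl
      have h0 := (e₀ k).2
      rw [hkl] at h0
      exact hi (hg (((h0 _).1 (((e₁ l).2 _).2 rfl)).symm))
    · rintro i (k | k) hik
      · exact n0 k i hik.symm
      · exact n1 k i hik.symm
  have hsurj : Function.Surjective φ := by
    intro v
    by_cases hv : v ∈ Set.range g
    · obtain ⟨i, rfl⟩ := hv
      exact ⟨.inl i, rfl⟩
    · rcases hleaf v hv with hl | hl
      · exact ⟨.inr (.inl (e₀.symm ⟨v, hl⟩)), by simp [φ]⟩
      · exact ⟨.inr (.inr (e₁.symm ⟨v, hl⟩)), by simp [φ]⟩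
  have h0 : ∀ k u, G.Adj (e₀ k).1 u ↔ u = g i₀ := fun k => (e₀ k).2
  have h1 : ∀ k u, G.Adj (e₁ k).1 u ↔ u = g i₁ := fun k => (e₁ k).2
  have hadj : ∀ p q, G.Adj (φ p) (φ q) ↔ (H.attachPendants (Sum.elim (fun _ => i₀)
      (fun _ => i₁))).Adj p q := by
    rintro (i | k | k) (j | l | l)
    · exact hH i j
    · change G.Adj (g i) (e₀ l).1 ↔ i = i₀
      rw [G.adj_comm, h0, hg.eq_iff]
    · change G.Adj (g i) (e₁ l).1 ↔ i = i₁
      rw [G.adj_comm, h1, hg.eq_iff]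
    · exact (h0 k (g j)).trans hg.eq_iff
    · exact iff_of_false (fun h => n0 l i₀ ((h0 k _).1 h)) id
    · exact iff_of_false (fun h => n1 l i₀ ((h0 k _).1 h)) id
    · exact (h1 k (g j)).trans hg.eq_iff
    · exact iff_of_false (fun h => n0 l i₁ ((h1 k _).1 h)) id
    · exact iff_of_false (fun h => n1 l i₁ ((h1 k _).1 h)) id
  exact ⟨RelIso.symm ⟨Equiv.ofBijective φ ⟨hinj, hsurj⟩, fun {p q} => hadj p q⟩⟩

theorem IsPendantTriangle.exists_iso [Fintype V] {a b c : V} (h : G.IsPendantTriangle a b c)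
    (hV : 4 ≤ Fintype.card V) : ∃ r s, s ≤ r ∧ 1 ≤ r + s ∧ Nonempty (G ≃g U₁ r s) := by
  -- Exchanging a and b arranges r ≥ s.
  wlog hle : Nat.card {v // G.IsLeafAt v b} ≤ Nat.card {v // G.IsLeafAt v a} generalizing a b
  · exact this h.symm (by omega)
  have hab := h.adj_ab
  have hbc := h.adj_bc
  have hca := h.adj_ca
  have hiso : Nonempty (G ≃g U₁ _ _) := nonempty_iso_attachPendants (G := G) (H := cycleGraph 3)
    (g := ![a, b, c]) (i₀ := 0) (i₁ := 1) ?_ ?_ ?_ (by decide) ?_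
  · refine ⟨_, _, hle, ?_, hiso⟩
    have := Nat.card_congr hiso.some.toEquiv
    rw [Nat.card_eq_fintype_card, Nat.card_sum, Nat.card_sum, Nat.card_fin, Nat.card_fin,
      Nat.card_fin] at this
    simp only [Matrix.cons_val] at this ⊢
    omega
  · intro i j
    fin_cases i <;> fin_cases j <;> simp [hab.ne, hab.ne', hbc.ne, hbc.ne', hca.ne, hca.ne']
  · intro i j
    rw [cycleGraph_three_adj]
    fin_cases i <;> fin_cases j <;> simp [hab, hab.symm, hbc, hbc.symm, hca, hca.symm]
  · intro i
    fin_cases i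
    · exact not_isLeafAt_of_adj_of_adj hab hca.symm hbc.ne
    · exact not_isLeafAt_of_adj_of_adj hbc hab.symm hca.ne
    · exact not_isLeafAt_of_adj_of_adj hca hbc.symm hab.ne
  · intro v hv
    simp only [Set.mem_range, not_exists] at hv
    exact h.leaf v (fun e => hv 0 e.symm) (fun e => hv 1 e.symm) (fun e => hv 2 e.symm)

theorem IsSquare.injective {a b c d : V} (h : G.IsSquare a b c d) :
    Function.Injective ![a, b, c, d] := by
  have := h.adj_ab.ne; have := h.adj_bc.ne; have := h.adj_cd.ne; have := h.adj_da.ne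
  have := h.ne_ac; have := h.ne_bd
  intro i j
  fin_cases i <;> fin_cases j <;> simp <;> grind

theorem IsSquare.adj_iff {a b c d : V} (h : G.IsSquare a b c d) (i j : Fin 4) :
    G.Adj (![a, b, c, d] i) (![a, b, c, d] j) ↔ (cycleGraph 4).Adj i j := by
  have := h.adj_ab; have := h.adj_bc; have := h.adj_cd; have := h.adj_da
  have := h.not_adj_ac; have := h.not_adj_bd
  rw [cycleGraph_four_adj]
  fin_cases i <;> fin_cases j <;> simp [*, G.adj_comm] <;> grind [G.adj_comm]

theorem IsSquare.not_isLeafAt {a b c d : V} (h : G.IsSquare a b c d) (i : Fin 4) (z : V) :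
    ¬ G.IsLeafAt (![a, b, c, d] i) z := by
  fin_cases i
  · exact not_isLeafAt_of_adj_of_adj h.adj_ab h.adj_da.symm h.ne_bd z
  · exact not_isLeafAt_of_adj_of_adj h.adj_bc h.adj_ab.symm h.ne_ac.symm z
  · exact not_isLeafAt_of_adj_of_adj h.adj_cd h.adj_bc.symm h.ne_bd.symm z
  · exact not_isLeafAt_of_adj_of_adj h.adj_da h.adj_cd.symm h.ne_ac z

theorem IsPendantSquare.exists_iso [Fintype V] {a b c d : V} (h : G.IsPendantSquare a b c d)
    (hV : 5 ≤ Fintype.card V) : ∃ r s, s ≤ r ∧ 1 ≤ r + s ∧ Nonempty (G ≃g U₂ r s) := by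
  wlog hle : Nat.card {v // G.IsLeafAt v c} ≤ Nat.card {v // G.IsLeafAt v a} generalizing a c
  · exact this h.symm (by omega)
  have hiso : Nonempty (G ≃g U₂ _ _) := nonempty_iso_attachPendants (G := G) (H := cycleGraph 4)
    (g := ![a, b, c, d]) (i₀ := 0) (i₁ := 2) h.injective h.adj_iff h.not_isLeafAt (by decide) ?_
  · refine ⟨_, _, hle, ?_, hiso⟩
    have := Nat.card_congr hiso.some.toEquiv
    rw [Nat.card_eq_fintype_card, Nat.card_sum, Nat.card_sum, Nat.card_fin, Nat.card_fin,
      Nat.card_fin] at this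
    simp only [Matrix.cons_val] at this ⊢
    omega
  · intro v hv
    simp only [Set.mem_range, not_exists] at hv
    exact h.leaf v (fun e => hv 0 e.symm) (fun e => hv 1 e.symm) (fun e => hv 2 e.symm)
      (fun e => hv 3 e.symm)

theorem IsBroomSquare.nonempty_iso [Finite V] {a b c d y : V} (h : G.IsBroomSquare a b c d y) :
    Nonempty (G ≃g U₃ (Nat.card {v // G.IsLeafAt v y})) := by
  let e := (Finite.equivFin {v // G.IsLeafAt v y}).symm
  set r := Nat.card {v // G.IsLeafAt v y}
  let ψ : {x : Fin 1 ⊕ Fin (r + 1) // x ≠ Sum.inr 0} → V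
    | ⟨.inl _, _⟩ => y
    -- The star's pendant vertex 0 has been merged into the square, so the others are shifted down
    -- by one to number the leaves at y.
    | ⟨.inr j, hj⟩ => (e (j.pred fun hj0 => hj (by rw [hj0]))).1
  let φ : Fin 4 ⊕ {x : Fin 1 ⊕ Fin (r + 1) // x ≠ Sum.inr 0} → V := Sum.elim ![a, b, c, d] ψ
  have he : ∀ k u, G.Adj (e k).1 u ↔ u = y := fun k => (e k).2
  have hyg : ∀ i, ![a, b, c, d] i ≠ y := by
    intro i
    fin_cases i
    · exact h.adj_ya.ne'
    · exact h.ne_yb.symm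
    · exact h.ne_yc.symm
    · exact h.ne_yd.symm
  have hyadj : ∀ i, G.Adj y (![a, b, c, d] i) ↔ i = 0 := by
    intro i
    fin_cases i <;> simp [h.adj_ya, h.not_adj_yb, h.not_adj_yc, h.not_adj_yd]
  have hey : ∀ k, (e k).1 ≠ y := fun k hk => ((he k y).2 rfl).ne hk
  have heg : ∀ k i, ![a, b, c, d] i ≠ (e k).1 := fun k i hk => h.not_isLeafAt i y (hk ▸ (e k).2)
  have hinj : Function.Injective φ := by
    refine Function.Injective.sumElim h.injective ?_ ?_
    · rintro ⟨(i | i), hi⟩ ⟨(j | j), hj⟩ hij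
      · simp [Subsingleton.elim i j]
      · exact absurd hij.symm (hey _)
      · exact absurd hij (hey _)
      · have := e.injective (Subtype.val_injective hij)
        rw [Fin.pred_inj] at this
        simp [this]
    · rintro i ⟨(j | j), hj⟩
      · exact hyg i
      · exact heg _ i
  have hsurj : Function.Surjective φ := by
    intro v
    by_cases hv : v ∈ Set.range ![a, b, c, d]
    · obtain ⟨i, rfl⟩ := hv
      exact ⟨.inl i, rfl⟩
    by_cases hvy : v = y
    · exact ⟨.inr ⟨.inl 0, by simp⟩, hvy.symm⟩
    simp only [Set.mem_range, not_exists] at hv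
    have hl := h.leaf v (fun e => hv 0 e.symm) (fun e => hv 1 e.symm) (fun e => hv 2 e.symm)
      (fun e => hv 3 e.symm) hvy
    exact ⟨.inr ⟨.inr (e.symm ⟨v, hl⟩).succ, by simp [Fin.succ_ne_zero]⟩, by simp [φ, ψ]⟩
  have hadj : ∀ p q, G.Adj (φ p) (φ q) ↔ (U₃ r).Adj p q := by
    rintro (i | ⟨(i | i), hi⟩) (j | ⟨(j | j), hj⟩)
    · exact h.adj_iff i j
    · change G.Adj (![a, b, c, d] i) y ↔ i = 0 ∧ (completeBipartiteGraph (Fin 1) (Fin (r + 1))).Adj _ _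
      rw [G.adj_comm, hyadj]
      simp
    · change G.Adj (![a, b, c, d] i) (e _).1 ↔ i = 0 ∧ (completeBipartiteGraph (Fin 1) (Fin (r + 1))).Adj _ _
      rw [G.adj_comm, he]
      simp [hyg]
    · change G.Adj y (![a, b, c, d] j) ↔ j = 0 ∧ (completeBipartiteGraph (Fin 1) (Fin (r + 1))).Adj _ _
      rw [hyadj]
      simp
    · change G.Adj y y ↔ (completeBipartiteGraph (Fin 1) (Fin (r + 1))).Adj _ _
      simp
    · change G.Adj y (e _).1 ↔ (completeBipartiteGraph (Fin 1) (Fin (r + 1))).Adj _ _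
      rw [G.adj_comm, he]
      simp
    · change G.Adj (e _).1 (![a, b, c, d] j) ↔ j = 0 ∧ (completeBipartiteGraph (Fin 1) (Fin (r + 1))).Adj _ _
      rw [he]
      simp [hyg]
    · change G.Adj (e _).1 y ↔ (completeBipartiteGraph (Fin 1) (Fin (r + 1))).Adj _ _
      rw [he]
      simp
    · change G.Adj (e _).1 (e _).1 ↔ (completeBipartiteGraph (Fin 1) (Fin (r + 1))).Adj _ _
      rw [he]
      simp [hey]
  exact ⟨RelIso.symm ⟨Equiv.ofBijective φ ⟨hinj, hsurj⟩, fun {p q} => hadj p q⟩⟩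

theorem exists_isPendantTriangle_of_iso {r s : ℕ} (φ : G ≃g U₁ r s) (h : 1 ≤ r + s) :
    ∃ a b c, G.IsPendantTriangle a b c ∧ ∃ w, w ≠ a ∧ w ≠ b ∧ w ≠ c := by
  have hadj : ∀ i j : Fin 3, i ≠ j → G.Adj (φ.symm (.inl i)) (φ.symm (.inl j)) := by
    intro i j hij
    rw [φ.symm.map_adj_iff]
    exact (cycleGraph_three_adj i j).2 hij
  refine ⟨φ.symm (.inl 0), φ.symm (.inl 1), φ.symm (.inl 2), ⟨hadj _ _ (by decide),
    hadj _ _ (by decide), hadj _ _ (by decide), ?_⟩, ?_⟩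
  · intro w h0 h1 h2
    obtain ⟨w, rfl⟩ := φ.symm.surjective w
    rcases w with i | k | k
    · fin_cases i
      · exact absurd rfl h0
      · exact absurd rfl h1
      · exact absurd rfl h2
    · left
      intro u
      obtain ⟨u, rfl⟩ := φ.symm.surjective u
      rw [φ.symm.map_adj_iff, φ.symm.injective.eq_iff]
      rcases u with j | l <;> simp [U₁, attachPendants]
    · right
      intro u
      obtain ⟨u, rfl⟩ := φ.symm.surjective u
      rw [φ.symm.map_adj_iff, φ.symm.injective.eq_iff]
      rcases u with j | l <;> simp [U₁, attachPendants]
  · have k : Fin r ⊕ Fin s := finSumFinEquiv.symm ⟨0, h⟩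
    exact ⟨φ.symm (.inr k), by simp⟩

theorem exists_isPendantSquare_of_iso {r s : ℕ} (φ : G ≃g U₂ r s) (h : 1 ≤ r + s) :
    ∃ a b c d, G.IsPendantSquare a b c d ∧ ∃ w, w ≠ a ∧ w ≠ b ∧ w ≠ c ∧ w ≠ d := by
  have hadj : ∀ i j : Fin 4, G.Adj (φ.symm (.inl i)) (φ.symm (.inl j)) ↔
      j = i + 1 ∨ i = j + 1 := by
    intro i j
    rw [φ.symm.map_adj_iff]
    exact cycleGraph_four_adj i j
  refine ⟨φ.symm (.inl 0), φ.symm (.inl 1), φ.symm (.inl 2), φ.symm (.inl 3),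
    ⟨⟨(hadj _ _).2 (by decide), (hadj _ _).2 (by decide), (hadj _ _).2 (by decide),
      (hadj _ _).2 (by decide), by simp, by simp, (hadj _ _).not.2 (by decide),
      (hadj _ _).not.2 (by decide)⟩, ?_⟩, ?_⟩
  · intro w h0 h1 h2 h3
    obtain ⟨w, rfl⟩ := φ.symm.surjective w
    rcases w with i | k | k
    · fin_cases i
      · exact absurd rfl h0
      · exact absurd rfl h1
      · exact absurd rfl h2
      · exact absurd rfl h3
    · left
      intro u
      obtain ⟨u, rfl⟩ := φ.symm.surjective u
      rw [φ.symm.map_adj_iff, φ.symm.injective.eq_iff]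
      rcases u with j | l <;> simp [U₂, attachPendants]
    · right
      intro u
      obtain ⟨u, rfl⟩ := φ.symm.surjective u
      rw [φ.symm.map_adj_iff, φ.symm.injective.eq_iff]
      rcases u with j | l <;> simp [U₂, attachPendants]
  · have k : Fin r ⊕ Fin s := finSumFinEquiv.symm ⟨0, h⟩
    exact ⟨φ.symm (.inr k), by simp⟩

theorem exists_isBroomSquare_of_iso {r : ℕ} (φ : G ≃g U₃ r) (h : 1 ≤ r) :
    ∃ a b c d y, G.IsBroomSquare a b c d y ∧
      ∃ w, w ≠ a ∧ w ≠ b ∧ w ≠ c ∧ w ≠ d ∧ w ≠ y := by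
  have hadj : ∀ i j : Fin 4, G.Adj (φ.symm (.inl i)) (φ.symm (.inl j)) ↔
      j = i + 1 ∨ i = j + 1 := by
    intro i j
    rw [φ.symm.map_adj_iff]
    exact cycleGraph_four_adj i j
  have hy : ∀ i : Fin 4, G.Adj (φ.symm (.inr ⟨.inl 0, by simp⟩)) (φ.symm (.inl i)) ↔ i = 0 := by
    intro i
    rw [φ.symm.map_adj_iff]
    simp [U₃, identify]
  refine ⟨φ.symm (.inl 0), φ.symm (.inl 1), φ.symm (.inl 2), φ.symm (.inl 3),
    φ.symm (.inr ⟨.inl 0, by simp⟩),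
    ⟨⟨(hadj _ _).2 (by decide), (hadj _ _).2 (by decide), (hadj _ _).2 (by decide),
      (hadj _ _).2 (by decide), by simp, by simp, (hadj _ _).not.2 (by decide),
      (hadj _ _).not.2 (by decide)⟩, (hy _).2 rfl, by simp, by simp, by simp,
      (hy _).not.2 (by decide), (hy _).not.2 (by decide), (hy _).not.2 (by decide), ?_⟩, ?_⟩
  · intro w h0 h1 h2 h3 h4
    obtain ⟨w, rfl⟩ := φ.symm.surjective w
    rcases w with i | ⟨k | k, hk⟩
    · fin_cases i
      · exact absurd rfl h0
      · exact absurd rfl h1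
      · exact absurd rfl h2
      · exact absurd rfl h3
    · obtain rfl := Subsingleton.elim k 0
      exact absurd rfl h4
    · intro u
      obtain ⟨u, rfl⟩ := φ.symm.surjective u
      rw [φ.symm.map_adj_iff, φ.symm.injective.eq_iff]
      rcases u with j | ⟨l | l, hl⟩ <;> simp [U₃, identify]
      exact Subsingleton.elim _ _
  · refine ⟨φ.symm (.inr ⟨.inr (Fin.succ ⟨0, h⟩), ?_⟩), ?_⟩
    · simp
    · simp

end SimpleGraph

/-! ### Assembly of the classification -/

theorem SignedGraph.exists_iso_of_rank_eq_four {V : Type*} [Fintype V] [DecidableEq V]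
    {Γ : SignedGraph V} (hn : 4 ≤ Fintype.card V) (hΓ : Γ.graph.IsUnicyclic) {x y : V}
    (hx : Γ.graph.IsLeafAt x y) (hr : Γ.adjMatrix.rank = 4) :
    (∃ r s : ℕ, s ≤ r ∧ 1 ≤ r + s ∧ Nonempty (Γ.graph ≃g SimpleGraph.U₁ r s)) ∨
      (∃ r s : ℕ, s ≤ r ∧ 1 ≤ r + s ∧ Nonempty (Γ.graph ≃g SimpleGraph.U₂ r s)) ∨
      (∃ r : ℕ, 1 ≤ r ∧ Nonempty (Γ.graph ≃g SimpleGraph.U₃ r) ∧ Γ.IsBalanced) := by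
  classical
  obtain ⟨P, Q, hPQ, hsign⟩ := SignedGraph.exists_isBicliqueApex hΓ.1.preconnected hx hr
  have hleafs : 1 ≤ Nat.card {v // Γ.graph.IsLeafAt v y} := by
    have : Nonempty {v // Γ.graph.IsLeafAt v y} := ⟨⟨x, hx⟩⟩
    exact Nat.card_pos
  rcases hPQ.classification hΓ with ⟨a, b, c, h⟩ | ⟨a, b, c, d, h⟩ |
    ⟨a, ha, b, hb, c, hc, d, hd, h⟩ | ⟨a, ha, b, hb, c, hc, d, hd, h⟩
  · exact .inl (h.exists_iso hn)
  -- A fifth vertex is needed to exclude r = s = 0; it is x, which as a leaf cannot lie on the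
  -- square.
  · refine .inr (.inl (h.exists_iso ?_))
    have hxg : x ∉ Set.range ![a, b, c, d] := by
      rintro ⟨i, rfl⟩
      exact h.not_isLeafAt i y hx
    have := Fintype.card_lt_of_injective_of_notMem _ h.injective hxg
    rwa [Fintype.card_fin] at this
  · refine .inr (.inr ⟨_, hleafs, h.nonempty_iso, ?_⟩)
    rw [SignedGraph.isBalanced_iff_of_square hΓ h.adj_ab h.adj_bc h.adj_cd h.adj_da h.ne_ac h.ne_bd]
    exact hsign a ha b hb c hc d hd
  · refine .inr (.inr ⟨_, hleafs, h.nonempty_iso, ?_⟩)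
    rw [SignedGraph.isBalanced_iff_of_square hΓ h.adj_ab h.adj_bc h.adj_cd h.adj_da h.ne_ac h.ne_bd]
    -- The parts have changed roles, so the square is read starting from b, which lies in P.
    rw [← hsign b hb c hc d hd a ha]
    ring

theorem mainTheorem2 {V : Type*} [Fintype V] [DecidableEq V] (Γ : SignedGraph V) (n : ℕ)
    (hcard : Fintype.card V = n) (hn : 4 ≤ n) (hΓ : Γ.graph.IsUnicyclic) :
    Γ.nullity = n - 4 ↔
      ((Nonempty (Γ.graph ≃g SimpleGraph.cycleGraph 4) ∧ ¬ Γ.IsBalanced) ∨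
        (Nonempty (Γ.graph ≃g SimpleGraph.cycleGraph 6) ∧ ¬ Γ.IsBalanced) ∨
        (∃ r s : ℕ, s ≤ r ∧ 1 ≤ r + s ∧ Nonempty (Γ.graph ≃g SimpleGraph.U₁ r s)) ∨
        (∃ r s : ℕ, s ≤ r ∧ 1 ≤ r + s ∧ Nonempty (Γ.graph ≃g SimpleGraph.U₂ r s)) ∨
        (∃ r : ℕ, 1 ≤ r ∧ Nonempty (Γ.graph ≃g SimpleGraph.U₃ r) ∧ Γ.IsBalanced)) := by
  classical
  subst hcard
  rw [Γ.nullity_eq_sub_four_iff hn]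
  constructor
  · intro hr
    by_cases hdeg : ∃ v, Γ.graph.degree v = 1
    · obtain ⟨x, hx⟩ := hdeg
      obtain ⟨y, hy⟩ := SimpleGraph.exists_isLeafAt_of_degree_eq_one hx
      exact .inr (.inr (SignedGraph.exists_iso_of_rank_eq_four hn hΓ hy hr))
    · obtain ⟨f, hf⟩ := hΓ.exists_isCycleLabelling (not_exists.1 hdeg) (by omega)
      rcases lt_or_ge (Fintype.card V) 7 with h7 | h7
      -- Only the cycles of length 4, 5 and 6 remain.
      · generalize Fintype.card V = m at *
        interval_cases m
        · exact .inl ⟨hf.nonempty_iso SimpleGraph.cycleGraph_four_adj_val,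
            (SignedGraph.rank_eq_four_iff_of_square hΓ hf).1 hr⟩
        · exact absurd hr (SignedGraph.rank_ne_four_of_pentagon hf)
        · exact .inr (.inl ⟨hf.nonempty_iso SimpleGraph.cycleGraph_six_adj_val,
            (SignedGraph.rank_eq_four_iff_of_hexagon hΓ hf).1 hr⟩)
      · exact absurd hr (SignedGraph.rank_ne_four_of_isCycleLabelling h7 hf)
  · rintro (⟨⟨φ⟩, hb⟩ | ⟨⟨φ⟩, hb⟩ | ⟨r, s, -, hrs, ⟨φ⟩⟩ | ⟨r, s, -, hrs, ⟨φ⟩⟩ | ⟨r, hr, ⟨φ⟩, hb⟩)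
    · obtain ⟨f, hf⟩ :=
        SimpleGraph.exists_isCycleLabelling_of_iso φ SimpleGraph.cycleGraph_four_adj_val
      exact (SignedGraph.rank_eq_four_iff_of_square hΓ hf).2 hb
    · obtain ⟨f, hf⟩ :=
        SimpleGraph.exists_isCycleLabelling_of_iso φ SimpleGraph.cycleGraph_six_adj_val
      exact (SignedGraph.rank_eq_four_iff_of_hexagon hΓ hf).2 hb
    · obtain ⟨a, b, c, h, hw⟩ := SimpleGraph.exists_isPendantTriangle_of_iso φ hrs
      exact SignedGraph.rank_eq_four_of_isPendantTriangle h hw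
    · obtain ⟨a, b, c, d, h, hw⟩ := SimpleGraph.exists_isPendantSquare_of_iso φ hrs
      exact SignedGraph.rank_eq_four_of_isPendantSquare h hw
    · obtain ⟨a, b, c, d, y, h, hw⟩ := SimpleGraph.exists_isBroomSquare_of_iso φ hr
      exact SignedGraph.rank_eq_four_of_isBroomSquare hΓ h hw hb
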